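/- **Definitions.** A loop is a set $Q$ with a binary operation and an identity element $1$ such that all left translations $L_a\colon b\mapsto ab$ and right translations $R_a\colon b\mapsto ba$ are bijections. Its inner mapping group is the stabilizer of $1$ in the permutation group generated by all $L_a,R_a$; $Q$ is *automorphic* if every inner mapping is an automorphism (such loops are power-associative, so $a^n$ makes sense for $n\in\mathbb Z$). The associator $(a,b,c)$ is the unique element with $(ab)c=(a(bc))\,(a,b,c)$. The center $Z(Q)$ consists of the elements that commute and associate with all elements of $Q$; put $Z_0(Q)=1$ and let $Z_{i+1}(Q)$ be the preimage of $Z(Q/Z_i(Q))$ in $Q$. $Q$ has nilpotency class $n$ if $Z_{n-1}(Q)\ne Q=Z_n(Q)$, and class at most $n$ if $Z_n(Q)=Q$. Let $F_3(x,y)$ be the free commutative automorphic loop of nilpotency class $3$ on free generators $x,y$, that is, the free object on $x,y$ in the variety of commutative automorphic loops of nilpotency class at most $3$. For $n\in\mathbb Z$ let $\alpha(n)=(n^3-n)/3$ and $\beta(n)=n^2-n$. Define $c=a*b$ for $a,b\in\mathbb Z^8$ by $$\begin{aligned} c_1&=a_1+b_1,\qquad c_2=a_2+b_2,\\ c_3&=a_3+b_3-a_1b_1(a_2+b_2),\qquad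 c_4=a_4+b_4+a_2b_2(a_1+b_1),\\ c_5&=a_5+b_5+(a_2+b_2)(b_1\alpha(a_1)+a_1\alpha(b_1))+a_2(a_1\beta(b_1)+b_1^2\beta(a_1))\\ &\quad+b_2(b_1\beta(a_1)+a_1^2\beta(b_1))-a_1b_1(a_3+b_3),\\ c_6&=a_6+b_6+2a_1a_2b_1b_2(a_1+b_1)+(a_2+b_2)(a_1\beta(b_1)+b_1\beta(a_1))\\ &\quad+(\beta(a_2)+\beta(b_2))(a_1b_1^2+b_1a_1^2)-a_2b_2\alpha(a_1+b_1)-a_1b_1(a_4+b_4)-(a_3+b_3)(a_1b_2+a_2b_1),\\ c_7&=a_7+b_7-2a_1a_2b_1b_2(a_2+b_2)-(a_1+b_1)(a_2\beta(b_2)+b_2\beta(a_2))\\ &\quad-(\beta(a_1)+\beta(b_1))(a_2b_2^2+b_2a_2^2)+a_1b_1\alpha(a_2+b_2)-a_2b_2(a_3+b_3)-(a_4+b_4)(a_1b_2+a_2b_1),\\ c_8&=a_8+b_8-(a_1+b_1)(a_2\alpha(b_2)+b_2\alpha(a_2))-a_1(a_2\beta(b_2)+b_2^2\beta(a_2))\\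 &\quad-b_1(b_2\beta(a_2)+a_2^2\beta(b_2))-a_2b_2(a_4+b_4). \end{aligned}$$ **Theorem.** The loop $F_3(x,y)$ exists and has nilpotency class exactly $3$. In $F_3(x,y)$ let $u_1=(x,x,y)$, $u_2=(x,y,y)$, $v_1=(x,x,u_1)$, $v_2=(x,x,u_2)$, $v_3=(y,y,u_1)$, $v_4=(y,y,u_2)$. Then every element of $F_3(x,y)$ can be written uniquely as $$\bigl(x^{a_1}y^{a_2}\cdot u_1^{a_3}u_2^{a_4}\bigr)\,v_1^{a_5}v_2^{a_6}v_3^{a_7}v_4^{a_8},\qquad a_i\in\mathbb Z,$$ and sending such an element to $(a_1,\dots,a_8)$ is an isomorphism of $F_3(x,y)$ onto $(\mathbb Z^8,*)$. In particular $(\mathbb Z^8,*)$ is itself a free commutative automorphic loop of nilpotency class $3$, on the free generators $e_1=(1,0,\dots,0)$ and $e_2=(0,1,0,\dots,0)$. -/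

import Mathlib

/-! ### Loops -/

/-- A loop: a set with a binary operation and a two-sided identity element such that all left
translations `b ↦ a * b` and all right translations `b ↦ b * a` are bijections. -/
class IsLoop (Q : Type*) [MulOneClass Q] : Prop where
  left_bijective : ∀ a : Q, Function.Bijective fun b : Q => a * b
  right_bijective : ∀ a : Q, Function.Bijective fun b : Q => b * a

namespace IsLoop

variable {Q : Type*} [MulOneClass Q]

/-- The left translation by `a`, as a permutation of the loop. -/
noncomputable def leftTranslation [IsLoop Q] (a : Q) : Equiv.Perm Q :=
  Equiv.ofBijective (fun b => a * b) (IsLoop.left_bijective a)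

/-- The associator `(a, b, c)`: the unique element `t` with
`(a * b) * c = (a * (b * c)) * t` (see `associator_spec`). -/
noncomputable def associator [IsLoop Q] (a b c : Q) : Q :=
  (leftTranslation (a * (b * c))).symm ((a * b) * c)

theorem associator_spec [IsLoop Q] (a b c : Q) :
    (a * b) * c = (a * (b * c)) * associator a b c :=
  ((leftTranslation (a * (b * c))).apply_symm_apply ((a * b) * c)).symm

/-- Integer powers: `a ^ n` is obtained from `1` by applying `n` times the left translation by
`a` (its inverse if `n < 0`). In a power-associative loop, in particular in every automorphic
loop, this is the power of `a` in the group generated by `a`. -/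
noncomputable def power [IsLoop Q] (a : Q) (n : ℤ) : Q :=
  (leftTranslation a ^ n) 1

variable (Q) in
/-- The multiplication group: the group of permutations generated by all left and right
translations. -/
def multiplicationGroup : Subgroup (Equiv.Perm Q) :=
  Subgroup.closure
    {σ | (∃ a : Q, ∀ b : Q, σ b = a * b) ∨ (∃ a : Q, ∀ b : Q, σ b = b * a)}

variable (Q) in
/-- The inner mapping group: the stabilizer of `1` in the multiplication group. -/
def innerMappingGroup : Subgroup (Equiv.Perm Q) :=
  multiplicationGroup Q ⊓ MulAction.stabilizer (Equiv.Perm Q) (1 : Q)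

/-- The congruence modulo `N`: the congruence generated by `a ~ a * n` for `n ∈ N`. When `N` is a
normal subloop of a loop, its classes are the cosets of `N`. -/
def cosetCon (N : Set Q) : Con Q :=
  conGen fun a b => ∃ n ∈ N, b = a * n

variable (Q) in
/-- The upper central series: `Z_0 = {1}` and `Z_{i+1}` is the preimage of the center of `Q / Z_i`
under the projection `Q → Q / Z_i`. Here `Set.center` is the set of all elements that commute and
associate with all others. -/
def upperCentral : ℕ → Set Q
  | 0 => {1}
  | i + 1 => {a | (a : (cosetCon (upperCentral i)).Quotient) ∈
      Set.center (cosetCon (upperCentral i)).Quotient}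

end IsLoop

/-- A commutative automorphic loop: a commutative loop all of whose inner mappings are
automorphisms. -/
structure IsCommAutomorphicLoop (Q : Type*) [MulOneClass Q] : Prop where
  isLoop : IsLoop Q
  comm : ∀ a b : Q, a * b = b * a
  automorphic : ∀ φ ∈ IsLoop.innerMappingGroup Q, ∀ a b : Q, φ (a * b) = φ a * φ b

/-- `F` is the free commutative automorphic loop of nilpotency class `n` on the free generators
`x`, `y`: it is free on `x`, `y` in the variety of commutative automorphic loops `L` of
nilpotency class at most `n` (that is, with `Z_n(L) = L`). -/
structure IsFreeCommAutomorphicLoop.{u, v} (n : ℕ) (F : Type u) [MulOneClass F] (x y : F) :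
    Prop where
  isCommAutomorphicLoop : IsCommAutomorphicLoop F
  nilpotent : IsLoop.upperCentral F n = Set.univ
  existsUnique_hom : ∀ (L : Type v) [MulOneClass L], IsCommAutomorphicLoop L →
    IsLoop.upperCentral L n = Set.univ →
      ∀ a b : L, ∃! f : F →* L, f x = a ∧ f y = b

/-! ### The loop `(ℤ⁸, *)` -/

/-- `ℤ⁸`, the set of octuples of integers. -/
@[ext]
structure IntOctuple where
  a1 : ℤ
  a2 : ℤ
  a3 : ℤ
  a4 : ℤ
  a5 : ℤ
  a6 : ℤ
  a7 : ℤ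
  a8 : ℤ

namespace IntOctuple

/-- `α(n) = (n³ - n) / 3`; the division is exact. -/
def α (n : ℤ) : ℤ := (n ^ 3 - n) / 3

/-- `β(n) = n² - n`. -/
def β (n : ℤ) : ℤ := n ^ 2 - n

/-- The multiplication `*` on `ℤ⁸`. -/
def mul (a b : IntOctuple) : IntOctuple where
  a1 := a.a1 + b.a1
  a2 := a.a2 + b.a2
  a3 := a.a3 + b.a3 - a.a1 * b.a1 * (a.a2 + b.a2)
  a4 := a.a4 + b.a4 + a.a2 * b.a2 * (a.a1 + b.a1)
  a5 := a.a5 + b.a5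
    + (a.a2 + b.a2) * (b.a1 * α a.a1 + a.a1 * α b.a1)
    + a.a2 * (a.a1 * β b.a1 + b.a1 ^ 2 * β a.a1)
    + b.a2 * (b.a1 * β a.a1 + a.a1 ^ 2 * β b.a1)
    - a.a1 * b.a1 * (a.a3 + b.a3)
  a6 := a.a6 + b.a6
    + 2 * a.a1 * a.a2 * b.a1 * b.a2 * (a.a1 + b.a1)
    + (a.a2 + b.a2) * (a.a1 * β b.a1 + b.a1 * β a.a1)
    + (β a.a2 + β b.a2) * (a.a1 * b.a1 ^ 2 + b.a1 * a.a1 ^ 2)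
    - a.a2 * b.a2 * α (a.a1 + b.a1)
    - a.a1 * b.a1 * (a.a4 + b.a4)
    - (a.a3 + b.a3) * (a.a1 * b.a2 + a.a2 * b.a1)
  a7 := a.a7 + b.a7
    - 2 * a.a1 * a.a2 * b.a1 * b.a2 * (a.a2 + b.a2)
    - (a.a1 + b.a1) * (a.a2 * β b.a2 + b.a2 * β a.a2)
    - (β a.a1 + β b.a1) * (a.a2 * b.a2 ^ 2 + b.a2 * a.a2 ^ 2)
    + a.a1 * b.a1 * α (a.a2 + b.a2)
    - a.a2 * b.a2 * (a.a3 + b.a3)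
    - (a.a4 + b.a4) * (a.a1 * b.a2 + a.a2 * b.a1)
  a8 := a.a8 + b.a8
    - (a.a1 + b.a1) * (a.a2 * α b.a2 + b.a2 * α a.a2)
    - a.a1 * (a.a2 * β b.a2 + b.a2 ^ 2 * β a.a2)
    - b.a1 * (b.a2 * β a.a2 + a.a2 ^ 2 * β b.a2)
    - a.a2 * b.a2 * (a.a4 + b.a4)

instance : Mul IntOctuple := ⟨mul⟩

instance : One IntOctuple := ⟨⟨0, 0, 0, 0, 0, 0, 0, 0⟩⟩

theorem mul_def (a b : IntOctuple) : a * b = mul a b := rfl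

theorem one_def : (1 : IntOctuple) = ⟨0, 0, 0, 0, 0, 0, 0, 0⟩ := rfl

instance : MulOneClass IntOctuple where
  one_mul a := by ext <;> simp [mul_def, one_def, mul, α, β]
  mul_one a := by ext <;> simp [mul_def, one_def, mul, α, β]

/-- `e₁ = (1, 0, 0, 0, 0, 0, 0, 0)`. -/
def e1 : IntOctuple := ⟨1, 0, 0, 0, 0, 0, 0, 0⟩

/-- `e₂ = (0, 1, 0, 0, 0, 0, 0, 0)`. -/
def e2 : IntOctuple := ⟨0, 1, 0, 0, 0, 0, 0, 0⟩

end IntOctuple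

namespace IsLoop

/-- The canonical word
`(x ^ a₁ y ^ a₂ · u₁ ^ a₃ u₂ ^ a₄) · v₁ ^ a₅ v₂ ^ a₆ v₃ ^ a₇ v₄ ^ a₈`. -/
noncomputable def canonicalWord {Q : Type*} [MulOneClass Q] [IsLoop Q] (x y : Q)
    (a : IntOctuple) : Q :=
  let u1 := associator x x y
  let u2 := associator x y y
  let v1 := associator x x u1
  let v2 := associator x x u2
  let v3 := associator y y u1
  let v4 := associator y y u2
  ((power x a.a1 * power y a.a2) * (power u1 a.a3 * power u2 a.a4)) *
    (((power v1 a.a5 * power v2 a.a6) * power v3 a.a7) * power v4 a.a8)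

end IsLoop

universe u v

/-!
The universal property of `(ℤ⁸, *)` is obtained without computing products of canonical words in an
arbitrary loop. The point is that in a commutative automorphic loop of nilpotency class at most
three that is generated by `x` and `y`, every element is a canonical word in `x` and `y`
(`Generates.exists_canonicalWord`). In `(ℤ⁸, *)` the canonical word in `e₁` and `e₂` with exponents
`n` is `n` itself (`IntOctuple.canonicalWord_e1_e2`). Hence, for `a` and `b` in a loop `L` of class
three, the subloop of `ℤ⁸ × L` generated by `(e₁, a)` and `(e₂, b)` is the graph of the map that
sends `n` to the canonical word in `a` and `b` with exponents `n`, and this map is a homomorphism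
(`IntOctuple.canonicalWord_mul`). That `(ℤ⁸, *)` is itself automorphic is a polynomial identity
(`IntOctuple.innerMap_mul`).

Canonical words exhaust the loop for the following reason. In class three, associators belong to an
abelian group `Stable Q` that acts on the loop by right multiplication. As inner mappings are
automorphisms, the associator is additive in each argument under this action (`assoc_mul_coe`), and
`c ↦ (p, q, c)` is a derivation of the associator (`assoc_assoc`). For `u₁ = (x, x, y)` and
`u₂ = (x, y, y)` this gives `(x, y, u₁) = (x, x, u₂)`, `(y, x, u₂) = (y, y, u₁)` and
`(x, u₁, y) = (x, u₂, y) = 1`, so modulo the four central elements `v₁, …, v₄` all associators of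
`u₁` and `u₂` with the generators vanish. An inner mapping that fixes the generators is trivial, so
it suffices to look at generators to detect central elements (`Generates.isMulCentral`): modulo
`v₁, …, v₄` the elements `u₁` and `u₂` are central, and modulo these the loop is an abelian group
generated by `x` and `y`.
-/

/-! ### Inner mappings of the loop of octuples -/

namespace IntOctuple

theorem three_mul_α (n : ℤ) : 3 * α n = n ^ 3 - n := by
  have h : (3 : ℤ) ∣ n ^ 3 - n := by
    have : (3 : ℤ) = (3 : ℕ) := rfl
    rw [this, ← ZMod.intCast_zmod_eq_zero_iff_dvd]
    push_cast
    rw [sub_eq_zero]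
    exact ZMod.pow_card (p := 3) _
  exact Int.mul_ediv_cancel' h

theorem α_add (m n : ℤ) : α (m + n) = α m + α n + m * n * (m + n) := by
  have h1 := three_mul_α m
  have h2 := three_mul_α n
  have h3 := three_mul_α (m + n)
  have : 3 * α (m + n) = 3 * (α m + α n + m * n * (m + n)) := by
    linear_combination h3 - h1 - h2
  omega

@[simp] theorem α_zero : α 0 = 0 := by simp [α]

/-- The value `c ↦ (a * b) \ (a * (b * c))` of the inner mapping attached to `a` and `b`. Since
the multiplication is triangular, each coordinate is that of `c` plus the defect
`a * (b * c) - (a * b) * c`, corrected by the changes of the third and the fourth coordinates. -/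
def innerMap (a b c : IntOctuple) : IntOctuple :=
  let p := mul a b
  let d := mul a (mul b c)
  let e := mul p c
  { a1 := c.a1
    a2 := c.a2
    a3 := c.a3 + (d.a3 - e.a3)
    a4 := c.a4 + (d.a4 - e.a4)
    a5 := c.a5 + (d.a5 - e.a5) + p.a1 * c.a1 * (d.a3 - e.a3)
    a6 := c.a6 + (d.a6 - e.a6) + p.a1 * c.a1 * (d.a4 - e.a4)
      + (d.a3 - e.a3) * (p.a1 * c.a2 + p.a2 * c.a1)
    a7 := c.a7 + (d.a7 - e.a7) + p.a2 * c.a2 * (d.a3 - e.a3)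
      + (d.a4 - e.a4) * (p.a1 * c.a2 + p.a2 * c.a1)
    a8 := c.a8 + (d.a8 - e.a8) + p.a2 * c.a2 * (d.a4 - e.a4) }

theorem mul_innerMap (a b c : IntOctuple) : (a * b) * innerMap a b c = a * (b * c) := by
  ext <;> simp only [mul_def, mul, innerMap] <;> ring

theorem mul_comm' (a b : IntOctuple) : a * b = b * a := by
  ext <;> simp only [mul_def, mul, α_add] <;> ring

set_option maxHeartbeats 4000000 in
/-- The inner mappings are multiplicative: an identity between integer polynomials in the
coordinates and the values of `α` at single coordinates, by the addition formula for `α`. -/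
theorem innerMap_mul (a b c d : IntOctuple) :
    innerMap a b (c * d) = innerMap a b c * innerMap a b d := by
  ext
  · simp only [mul_def, mul, innerMap]
  · simp only [mul_def, mul, innerMap]
  · simp only [mul_def, mul, innerMap]; ring
  · simp only [mul_def, mul, innerMap]; ring
  · simp only [mul_def, mul, innerMap, α_add, β]; ring
  · simp only [mul_def, mul, innerMap, α_add, β]; ring
  · simp only [mul_def, mul, innerMap, α_add, β]; ring
  · simp only [mul_def, mul, innerMap, α_add, β]; ring

end IntOctuple

/-! ### Left division -/

namespace IsLoop

variable {Q R : Type*} [MulOneClass Q] [MulOneClass R] [IsLoop Q] [IsLoop R]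

/-- The left division `a \ b`: the unique `c` with `a * c = b`. -/
noncomputable def ldiv (a b : Q) : Q := (leftTranslation a).symm b

theorem leftTranslation_apply (a b : Q) : leftTranslation a b = a * b := rfl

instance : IsCancelMul Q where
  mul_left_cancel a _ _ h := (IsLoop.left_bijective a).1 h
  mul_right_cancel a _ _ h := (IsLoop.right_bijective a).1 h

@[simp] theorem mul_ldiv (a b : Q) : a * ldiv a b = b :=
  (leftTranslation a).apply_symm_apply b

@[simp] theorem ldiv_mul (a b : Q) : ldiv a (a * b) = b :=
  (leftTranslation a).symm_apply_apply b

theorem ldiv_eq_iff {a b c : Q} : ldiv a b = c ↔ b = a * c :=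
  (leftTranslation a).symm_apply_eq

theorem associator_eq_iff {a b c t : Q} :
    associator a b c = t ↔ (a * b) * c = (a * (b * c)) * t :=
  (leftTranslation (a * (b * c))).symm_apply_eq

theorem associator_eq_one_iff {a b c : Q} :
    associator a b c = 1 ↔ (a * b) * c = a * (b * c) := by
  rw [associator_eq_iff, mul_one]

/-! ### Powers and homomorphisms -/

@[simp] theorem power_zero (a : Q) : power a 0 = 1 := by simp [power]

theorem power_add_one (a : Q) (n : ℤ) : power a (n + 1) = a * power a n := by
  simp [power, add_comm n, zpow_add, leftTranslation_apply]

@[simp] theorem power_one (a : Q) : power a 1 = a := by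
  simpa using power_add_one a 0

/-- A family `p` with `p 0 = 1` and `p (n + 1) = a * p n` is the family of powers of `a`. -/
theorem power_eq_of_add_one {a : Q} {p : ℤ → Q} (h0 : p 0 = 1)
    (h1 : ∀ n, p (n + 1) = a * p n) (n : ℤ) : power a n = p n := by
  induction n using Int.induction_on with
  | zero => simp [h0]
  | succ n ih => rw [power_add_one, h1, ih]
  | pred n ih =>
    apply mul_left_cancel (a := a)
    rw [← power_add_one, ← h1, sub_add_cancel, ih]

theorem map_power (f : Q →* R) (a : Q) (n : ℤ) : f (power a n) = power (f a) n := by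
  refine (power_eq_of_add_one (p := fun n => f (power a n)) (by simp) (fun n => ?_) n).symm
  rw [power_add_one, map_mul]

theorem map_associator (f : Q →* R) (a b c : Q) :
    f (associator a b c) = associator (f a) (f b) (f c) := by
  refine (associator_eq_iff.2 ?_).symm
  rw [← map_mul, ← map_mul, ← map_mul, ← map_mul, ← map_mul, ← associator_spec]

theorem map_ldiv (f : Q →* R) (a b : Q) : f (ldiv a b) = ldiv (f a) (f b) := by
  refine (ldiv_eq_iff.2 ?_).symm
  rw [← map_mul, mul_ldiv]

theorem map_canonicalWord (f : Q →* R) (x y : Q) (n : IntOctuple) :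
    f (canonicalWord x y n) = canonicalWord (f x) (f y) n := by
  simp only [canonicalWord, map_mul, map_power, map_associator]

end IsLoop

/-! ### Central elements and quotients by central subgroups -/

/-- A one-sided inverse of a central element is central. -/
theorem IsMulCentral.of_mul_eq_one {Q : Type*} [MulOneClass Q] {n m : Q} (hn : IsMulCentral n)
    (h : n * m = 1) : IsMulCentral m := by
  have h' : m * n = 1 := by rw [← h, (hn.comm m).eq]
  have hnm (a : Q) : n * (m * a) = a := by rw [hn.left_assoc, h, one_mul]
  have hcancel {a b : Q} (hab : n * a = n * b) : a = b := by
    rw [← one_mul a, ← one_mul b, ← h', hn.mid_assoc, hn.mid_assoc, hab]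
  have hcomm (a : Q) : m * a = a * m := by
    apply hcancel
    rw [hnm, hn.left_assoc, (hn.comm a).eq, hn.mid_assoc, h, mul_one]
  refine ⟨hcomm, fun a b => ?_, fun a b => ?_⟩
  · apply hcancel
    rw [hnm, hn.left_assoc, hnm]
  · apply hcancel
    rw [← hcomm, hnm, ← hcomm b, hn.left_comm, hnm]

theorem IsMulCentral.mul_mul_mul_comm {Q : Type*} [Mul Q] {m n : Q} (hm : IsMulCentral m)
    (hn : IsMulCentral n) (a b : Q) : (a * m) * (b * n) = (a * b) * (m * n) := by
  rw [← hn.right_assoc, ← hm.right_comm, hn.right_assoc]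

namespace IsLoop

/-- `N` is a subgroup of the center of `Q`. -/
structure IsCentralSubgroup {Q : Type*} [MulOneClass Q] (N : Set Q) : Prop where
  isMulCentral : ∀ n ∈ N, IsMulCentral n
  one_mem : 1 ∈ N
  mul_mem : ∀ m ∈ N, ∀ n ∈ N, m * n ∈ N
  exists_inv : ∀ n ∈ N, ∃ m ∈ N, n * m = 1

/-- The congruence modulo a subgroup of the center. -/
def centralCon {Q : Type*} [MulOneClass Q] {N : Set Q} (hN : IsCentralSubgroup N) : Con Q where
  r a b := ∃ n ∈ N, b = a * n
  iseqv := by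
    refine ⟨fun a => ⟨1, hN.one_mem, (mul_one a).symm⟩, ?_, ?_⟩
    · rintro a _ ⟨n, hn, rfl⟩
      obtain ⟨m, hm, h⟩ := hN.exists_inv n hn
      exact ⟨m, hm, by rw [(hN.isMulCentral m hm).right_assoc, h, mul_one]⟩
    · rintro a _ _ ⟨n, hn, rfl⟩ ⟨m, hm, rfl⟩
      exact ⟨n * m, hN.mul_mem n hn m hm, (hN.isMulCentral m hm).right_assoc a n⟩
  mul' := by
    rintro a _ b _ ⟨n, hn, rfl⟩ ⟨m, hm, rfl⟩
    exact ⟨n * m, hN.mul_mem n hn m hm,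
      (hN.isMulCentral n hn).mul_mul_mul_comm (hN.isMulCentral m hm) a b⟩

theorem isCentralSubgroup_center {Q : Type*} [MulOneClass Q] [IsLoop Q] :
    IsCentralSubgroup (Set.center Q) where
  isMulCentral _ h := h
  one_mem := Set.one_mem_center
  mul_mem _ hm _ hn := Set.mul_mem_center hm hn
  exists_inv n hn := ⟨ldiv n 1, IsMulCentral.of_mul_eq_one hn (mul_ldiv n 1), mul_ldiv n 1⟩

open scoped Pointwise in
theorem IsCentralSubgroup.mul {Q : Type*} [MulOneClass Q] {M N : Set Q}
    (hM : IsCentralSubgroup M) (hN : IsCentralSubgroup N) :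
    IsCentralSubgroup (M * N) where
  isMulCentral := by
    rintro _ ⟨a, ha, b, hb, rfl⟩
    exact Set.mul_mem_center (hM.isMulCentral a ha) (hN.isMulCentral b hb)
  one_mem := ⟨1, hM.one_mem, 1, hN.one_mem, mul_one 1⟩
  mul_mem := by
    rintro _ ⟨a, ha, b, hb, rfl⟩ _ ⟨a', ha', b', hb', rfl⟩
    exact ⟨a * a', hM.mul_mem a ha a' ha', b * b', hN.mul_mem b hb b' hb',
      ((hN.isMulCentral b hb).mul_mul_mul_comm (hN.isMulCentral b' hb') a a').symm⟩
  exists_inv := by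
    rintro _ ⟨a, ha, b, hb, rfl⟩
    obtain ⟨m, hm, h⟩ := hM.exists_inv a ha
    obtain ⟨n, hn, h'⟩ := hN.exists_inv b hb
    refine ⟨m * n, ⟨m, hm, n, hn, rfl⟩, ?_⟩
    rw [(hN.isMulCentral b hb).mul_mul_mul_comm (hN.isMulCentral n hn), h, h', mul_one]

section Power

variable {Q : Type*} [MulOneClass Q] [IsLoop Q]

theorem isMulCentral_power {v : Q} (hv : IsMulCentral v) (n : ℤ) :
    IsMulCentral (power v n) := by
  induction n using Int.induction_on with
  | zero => rw [power_zero]; exact Set.one_mem_center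
  | succ n ih => rw [power_add_one]; exact Set.mul_mem_center hv ih
  | pred n ih =>
    have h := power_add_one v (-(n : ℤ) - 1)
    rw [sub_add_cancel] at h
    have hw : IsMulCentral (ldiv v 1) := IsMulCentral.of_mul_eq_one hv (mul_ldiv v 1)
    have : power v (-(n : ℤ) - 1) = ldiv v 1 * power v (-n) := by
      rw [h, hw.left_assoc, ← (hw.comm v).symm.eq, mul_ldiv, one_mul]
    rw [this]
    exact Set.mul_mem_center hw ih

theorem power_add {v : Q} (hv : IsMulCentral v) (m n : ℤ) :
    power v (m + n) = power v m * power v n := by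
  induction m using Int.induction_on with
  | zero => simp
  | succ m ih => rw [add_right_comm, power_add_one, ih, power_add_one, hv.left_assoc]
  | pred m ih =>
    apply mul_left_cancel (a := v)
    rw [← power_add_one, hv.left_assoc, ← power_add_one, sub_add_cancel, ← ih]
    congr 1
    ring

theorem isCentralSubgroup_power {v : Q} (hv : IsMulCentral v) :
    IsCentralSubgroup (Set.range (power v)) where
  isMulCentral := by
    rintro _ ⟨n, rfl⟩
    exact isMulCentral_power hv n
  one_mem := ⟨0, power_zero v⟩
  mul_mem := by
    rintro _ ⟨m, rfl⟩ _ ⟨n, rfl⟩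
    exact ⟨m + n, power_add hv m n⟩
  exists_inv := by
    rintro _ ⟨n, rfl⟩
    exact ⟨power v (-n), ⟨-n, rfl⟩, by rw [← power_add hv, add_neg_cancel, power_zero]⟩

end Power

end IsLoop

/-! ### Commutative automorphic loops -/

/-- Commutative automorphic loops, described by quasi-identities: `(a * b) * s = a * (b * c)` says
that `s` is the value at `c` of the inner mapping attached to `a` and `b`, and these inner mappings
are required to be multiplicative. -/
class CommAutomorphicLoop (Q : Type*) [MulOneClass Q] : Prop extends IsLoop Q where
  mul_comm' : ∀ a b : Q, a * b = b * a
  inner_mul' : ∀ a b c d s t : Q, (a * b) * s = a * (b * c) → (a * b) * t = a * (b * d) →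
    (a * b) * (s * t) = a * (b * (c * d))

/-- A commutative magma with identity is a loop if its left translations are bijective. -/
theorem IsLoop.of_comm {Q : Type*} [MulOneClass Q] (hcomm : ∀ a b : Q, a * b = b * a)
    (h : ∀ a : Q, Function.Bijective fun b : Q => a * b) : IsLoop Q where
  left_bijective := h
  right_bijective a := by
    simpa only [hcomm _ a] using h a

namespace CommAutomorphicLoop

open IsLoop

section Basic

variable {Q : Type*} [MulOneClass Q] [CommAutomorphicLoop Q]

protected theorem mul_comm (a b : Q) : a * b = b * a := mul_comm' a b

/-- The inner mapping `c ↦ (a * b) \ (a * (b * c))`, as an automorphism. -/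
noncomputable def inner (a b : Q) : Q ≃* Q where
  toEquiv := ((leftTranslation b).trans (leftTranslation a)).trans (leftTranslation (a * b)).symm
  map_mul' c d := ldiv_eq_iff.2
    (inner_mul' a b c d _ _ (mul_ldiv (a * b) (a * (b * c))) (mul_ldiv (a * b) (a * (b * d)))).symm

theorem mul_inner (a b c : Q) : (a * b) * inner a b c = a * (b * c) :=
  mul_ldiv (a * b) (a * (b * c))

theorem inner_eq_iff {a b c d : Q} : inner a b c = d ↔ a * (b * c) = (a * b) * d :=
  ldiv_eq_iff

theorem inner_eq_self_iff {a b c : Q} : inner a b c = c ↔ (a * b) * c = a * (b * c) := by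
  rw [inner_eq_iff, eq_comm]

theorem inner_of_isMulCentral (a b : Q) {n : Q} (hn : IsMulCentral n) : inner a b n = n :=
  inner_eq_self_iff.2 (hn.right_assoc a b)

theorem isMulCentral_of_left_assoc {n : Q} (h : ∀ a b : Q, n * (a * b) = (n * a) * b) :
    IsMulCentral n := by
  refine ⟨CommAutomorphicLoop.mul_comm n, h, fun a b => ?_⟩
  rw [CommAutomorphicLoop.mul_comm _ n, CommAutomorphicLoop.mul_comm a b, h,
    CommAutomorphicLoop.mul_comm n b, CommAutomorphicLoop.mul_comm a]

/-- Associativity of a triple is inherited by the reversed triple. -/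
theorem assoc_reverse {a b c : Q} (h : (a * b) * c = a * (b * c)) :
    (c * b) * a = c * (b * a) := by
  rw [CommAutomorphicLoop.mul_comm c b, CommAutomorphicLoop.mul_comm _ a, ← h,
    CommAutomorphicLoop.mul_comm c, CommAutomorphicLoop.mul_comm a b]

/-- If two of the three cyclic rotations of a triple associate, then so does the third. -/
theorem assoc_rotate {a b c : Q} (h : (a * b) * c = a * (b * c))
    (h' : (b * c) * a = b * (c * a)) : (c * a) * b = c * (a * b) := by
  rw [CommAutomorphicLoop.mul_comm c (a * b), h, CommAutomorphicLoop.mul_comm a (b * c), h',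
    CommAutomorphicLoop.mul_comm b]

theorem assoc_self (a b : Q) : (a * b) * a = a * (b * a) := by
  rw [CommAutomorphicLoop.mul_comm _ a, CommAutomorphicLoop.mul_comm a b]

/-- `x` and `y` generate the loop `Q`. -/
def Generates (x y : Q) : Prop :=
  ∀ S : Set Q, x ∈ S → y ∈ S → (∀ a ∈ S, ∀ b ∈ S, a * b ∈ S) →
    (∀ a ∈ S, ∀ b ∈ S, ldiv a b ∈ S) → ∀ a, a ∈ S

/-- Two homomorphisms that agree on generators are equal. -/
theorem Generates.hom_eq {R : Type*} [MulOneClass R] [IsLoop R] {x y : Q} (hxy : Generates x y)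
    {f g : Q →* R} (hx : f x = g x) (hy : f y = g y) (a : Q) : f a = g a := by
  refine hxy {a | f a = g a} hx hy (fun a ha b hb => ?_) (fun a ha b hb => ?_) a
  · change f (a * b) = g (a * b)
    rw [map_mul, map_mul, ha, hb]
  · change f (ldiv a b) = g (ldiv a b)
    rw [map_ldiv, map_ldiv, ha, hb]

/-- A pair of elements that associates with both generators associates with everything, because
the inner mapping attached to the pair is an automorphism that fixes the generators. -/
theorem Generates.assoc_right {x y : Q} (hxy : Generates x y) {a b : Q}
    (hx : (a * b) * x = a * (b * x)) (hy : (a * b) * y = a * (b * y)) (c : Q) :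
    (a * b) * c = a * (b * c) :=
  inner_eq_self_iff.1 <| hxy.hom_eq (f := (inner a b).toMonoidHom) (g := MonoidHom.id Q)
    (inner_eq_self_iff.2 hx) (inner_eq_self_iff.2 hy) c

/-- An element is central if it associates, in all positions, with each pair of generators. -/
theorem Generates.isMulCentral {x y : Q} (hxy : Generates x y) {w : Q}
    (hxx : (x * x) * w = x * (x * w)) (hyy : (y * y) * w = y * (y * w))
    (h : (x * y) * w = x * (y * w)) (h' : (x * w) * y = x * (w * y)) : IsMulCentral w := by
  have hwyx : (w * y) * x = w * (y * x) := assoc_reverse h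
  have hwxy : (w * x) * y = w * (x * y) := assoc_reverse (assoc_rotate h' hwyx)
  have hx (c : Q) : (w * c) * x = w * (c * x) :=
    assoc_rotate (assoc_reverse (hxy.assoc_right (assoc_reverse hxx) hwxy c))
      (hxy.assoc_right (assoc_self x w) h' c)
  have hy (c : Q) : (w * c) * y = w * (c * y) :=
    assoc_rotate (assoc_reverse (hxy.assoc_right hwyx (assoc_reverse hyy) c))
      (hxy.assoc_right (assoc_reverse h') (assoc_self y w) c)
  exact isMulCentral_of_left_assoc fun a b => (hxy.assoc_right (hx a) (hy a) b).symm

/-- A commutative automorphic loop generated by `x` and `y` is associative if `x, x, y` and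
`x, y, y` associate. -/
theorem Generates.isMulCentral_of_assoc {x y : Q} (hxy : Generates x y)
    (hx : (x * x) * y = x * (x * y)) (hy : (x * y) * y = x * (y * y)) (w : Q) :
    IsMulCentral w := by
  have h (c : Q) : (x * y) * c = x * (y * c) := hxy.assoc_right (assoc_self x y) hy c
  have h' (c : Q) : (y * x) * c = y * (x * c) :=
    hxy.assoc_right (assoc_reverse hx) (assoc_self y x) c
  exact hxy.isMulCentral (hxy.assoc_right (assoc_self x x) hx w)
    (hxy.assoc_right (assoc_reverse hy) (assoc_self y y) w) (h w)
    (assoc_rotate (assoc_reverse (h w)) (h' w))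

open scoped Pointwise in
theorem Generates.exists_power_mul_power {x y : Q} (hxy : Generates x y)
    (hc : ∀ a : Q, IsMulCentral a) (a : Q) : ∃ i j : ℤ, a = power x i * power y j := by
  have hx := isCentralSubgroup_power (hc x)
  have hy := isCentralSubgroup_power (hc y)
  have hS := hx.mul hy
  obtain ⟨_, ⟨i, rfl⟩, _, ⟨j, rfl⟩, h⟩ := hxy
    (Set.range (power x) * Set.range (power y))
    (Set.mem_mul.2 ⟨x, ⟨1, power_one x⟩, 1, hy.one_mem, mul_one x⟩)
    (Set.mem_mul.2 ⟨1, hx.one_mem, y, ⟨1, power_one y⟩, one_mul y⟩) hS.mul_mem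
    (fun a ha b hb => by
      obtain ⟨m, hm, h⟩ := hS.exists_inv a ha
      have : ldiv a b = m * b := ldiv_eq_iff.2 (by rw [(hc a).left_assoc, h, one_mul])
      rw [this]
      exact hS.mul_mem m hm b hb) a
  exact ⟨i, j, h.symm⟩

end Basic

section Quotient

variable {Q : Type*} [MulOneClass Q] [CommAutomorphicLoop Q] (c : Con Q)

/-- The quotient by a cancellative congruence is again a commutative automorphic loop. -/
theorem quotient (hc : ∀ a b d : Q, c (d * a) (d * b) → c a b) :
    CommAutomorphicLoop c.Quotient := by
  have hcancel (a b d : c.Quotient) (h : d * a = d * b) : a = b := by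
    induction a, b using Con.induction_on₂ with | _ a b
    induction d using Con.induction_on with | _ d
    rw [← Con.coe_mul, ← Con.coe_mul, Con.eq] at h
    exact (Con.eq c).2 (hc a b d h)
  have hcomm (a b : c.Quotient) : a * b = b * a := by
    induction a, b using Con.induction_on₂ with | _ a b
    rw [← Con.coe_mul, CommAutomorphicLoop.mul_comm, Con.coe_mul]
  have hloop : IsLoop c.Quotient := IsLoop.of_comm hcomm fun d => by
    refine ⟨fun a b h => hcancel a b d h, fun a => ?_⟩
    induction a, d using Con.induction_on₂ with | _ a d
    exact ⟨(ldiv d a : Q), congrArg _ (mul_ldiv d a)⟩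
  refine { hloop with mul_comm' := hcomm, inner_mul' := fun a b d e s t hs ht => ?_ }
  induction a, b using Con.induction_on₂ with | _ a b
  induction d, e using Con.induction_on₂ with | _ d e
  obtain rfl : s = (inner a b d : Q) := by
    refine hcancel _ _ (a * b : Q) ?_
    rw [← Con.coe_mul _ (inner a b d), mul_inner]
    exact hs
  obtain rfl : t = (inner a b e : Q) := by
    refine hcancel _ _ (a * b : Q) ?_
    rw [← Con.coe_mul _ (inner a b e), mul_inner]
    exact ht
  simp only [← Con.coe_mul]
  rw [← map_mul, mul_inner]

theorem centralCon_quotient {N : Set Q} (hN : IsCentralSubgroup N) :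
    CommAutomorphicLoop (centralCon hN).Quotient :=
  quotient _ fun a _ d ⟨n, hn, h⟩ =>
    ⟨n, hn, mul_left_cancel (h.trans ((hN.isMulCentral n hn).right_assoc d a))⟩

theorem Generates.quotient {x y : Q} (hxy : Generates x y) [CommAutomorphicLoop c.Quotient] :
    Generates (x : c.Quotient) (y : c.Quotient) := by
  intro S hx hy hmul hldiv a
  induction a using Con.induction_on with | _ a
  refine hxy ((c.mk' : Q → c.Quotient) ⁻¹' S) hx hy (fun a ha b hb => ?_)
    (fun a ha b hb => ?_) a
  · exact hmul _ ha _ hb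
  · change c.mk' (ldiv a b) ∈ S
    rw [map_ldiv]
    exact hldiv _ ha _ hb

end Quotient

end CommAutomorphicLoop

namespace CommAutomorphicLoop

open IsLoop

/-! ### Associators in class three -/

/-- The second center: the elements `z` that associate with all pairs of elements up to central
factors. -/
def secondCenter (Q : Type*) [MulOneClass Q] : Set Q :=
  {z | ∀ a b : Q, ∃ n ∈ Set.center Q, (z * a) * b = (z * (a * b)) * n}

section SecondCenter

variable {Q : Type*} [MulOneClass Q] [CommAutomorphicLoop Q]

theorem mem_secondCenter_iff {z : Q} : z ∈ secondCenter Q ↔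
    IsMulCentral (z : (centralCon (isCentralSubgroup_center (Q := Q))).Quotient) := by
  have := centralCon_quotient (isCentralSubgroup_center (Q := Q))
  refine ⟨fun h => isMulCentral_of_left_assoc fun a b => ?_, fun h a b => ?_⟩
  · induction a, b using Con.induction_on₂ with | _ a b
    exact (Con.eq _).2 (h a b)
  · exact (Con.eq _).1 (h.left_assoc (a : (centralCon _).Quotient) (b : (centralCon _).Quotient))

theorem isMulCentral_mem_secondCenter {Q : Type*} [MulOneClass Q] {n : Q}
    (hn : IsMulCentral n) : n ∈ secondCenter Q :=
  fun a b => ⟨1, Set.one_mem_center, by rw [mul_one, hn.left_assoc]⟩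

theorem mul_mem_secondCenter {z w : Q} (hz : z ∈ secondCenter Q) (hw : w ∈ secondCenter Q) :
    z * w ∈ secondCenter Q :=
  mem_secondCenter_iff.2 (Set.mul_mem_center (mem_secondCenter_iff.1 hz)
    (mem_secondCenter_iff.1 hw))

theorem mem_secondCenter_of_mul_eq_one {z w : Q} (hz : z ∈ secondCenter Q) (h : z * w = 1) :
    w ∈ secondCenter Q :=
  mem_secondCenter_iff.2 ((mem_secondCenter_iff.1 hz).of_mul_eq_one (congrArg _ h))

variable (Q) in
/-- The elements of the second center that are fixed by the inner mappings attached to pairs with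
one member in the second center. They form an abelian group, which contains all associators when
`Q` has class three, and which acts on `Q` by right multiplication. -/
structure Stable where
  /-- The underlying element of the loop. -/
  val : Q
  mem_secondCenter : val ∈ secondCenter Q
  inner_eq : ∀ z ∈ secondCenter Q, ∀ p : Q, inner p z val = val ∧ inner z p val = val

namespace Stable

attribute [coe] val

instance : CoeOut (Stable Q) Q := ⟨val⟩

theorem ext {w w' : Stable Q} (h : (w : Q) = w') : w = w' := by
  cases w
  cases w'
  cases h
  rfl

instance : Mul (Stable Q) :=
  ⟨fun w w' => ⟨(w : Q) * w', mul_mem_secondCenter w.2 w'.2, fun z hz p => by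
    simp only [map_mul, (w.3 z hz p).1, (w'.3 z hz p).1, (w.3 z hz p).2, (w'.3 z hz p).2,
      and_self]⟩⟩

/-- A central element, as a stable element. -/
def ofCentral (n : Q) (hn : IsMulCentral n) : Stable Q :=
  ⟨n, isMulCentral_mem_secondCenter hn, fun _ _ _ =>
    ⟨inner_of_isMulCentral _ _ hn, inner_of_isMulCentral _ _ hn⟩⟩

instance : One (Stable Q) := ⟨ofCentral 1 Set.one_mem_center⟩

noncomputable instance : Inv (Stable Q) :=
  ⟨fun w => ⟨ldiv (w : Q) 1, mem_secondCenter_of_mul_eq_one w.2 (mul_ldiv _ _), fun z hz p => by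
    constructor
    · have h := map_ldiv (inner p z).toMonoidHom (w : Q) 1
      rw [map_one] at h
      exact h.trans (congrArg (ldiv · 1) (w.3 z hz p).1)
    · have h := map_ldiv (inner z p).toMonoidHom (w : Q) 1
      rw [map_one] at h
      exact h.trans (congrArg (ldiv · 1) (w.3 z hz p).2)⟩⟩

theorem coe_mul (w w' : Stable Q) : ((w * w' : Stable Q) : Q) = w * w' := rfl

theorem coe_one : ((1 : Stable Q) : Q) = 1 := rfl

theorem mul_coe_mul_coe (a : Q) (w w' : Stable Q) : (a * w) * w' = a * (w * w' : Stable Q) :=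
  inner_eq_self_iff.1 (w'.3 w w.2 a).1

noncomputable instance : CommGroup (Stable Q) where
  mul_assoc u v w := ext (mul_coe_mul_coe (u : Q) v w)
  one_mul w := ext (one_mul (w : Q))
  mul_one w := ext (mul_one (w : Q))
  inv_mul_cancel w := ext ((CommAutomorphicLoop.mul_comm _ _).trans (mul_ldiv (w : Q) 1))
  mul_comm u v := ext (CommAutomorphicLoop.mul_comm (u : Q) v)

theorem mul_coe_right_cancel {a : Q} {w w' : Stable Q} (h : a * w = a * w') : w = w' :=
  ext (mul_left_cancel h)

variable (Q) in
/-- The center of `Q`, as a subgroup of the stable elements. -/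
noncomputable def centralSubgroup : Subgroup (Stable Q) where
  carrier := {w | IsMulCentral (w : Q)}
  one_mem' := Set.one_mem_center
  mul_mem' := Set.mul_mem_center
  inv_mem' {w} hw := IsMulCentral.of_mul_eq_one hw (mul_ldiv (w : Q) 1)

theorem mem_centralSubgroup {w : Stable Q} :
    w ∈ centralSubgroup Q ↔ IsMulCentral (w : Q) := Iff.rfl

end Stable

end SecondCenter

/-- Commutative automorphic loops of nilpotency class at most three: all associators belong to the
second center. -/
class ClassThree (Q : Type*) [MulOneClass Q] : Prop extends CommAutomorphicLoop Q where
  exists_associator : ∀ a b c : Q, ∃ z ∈ secondCenter Q, (a * b) * c = (a * (b * c)) * z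

section ClassThree

variable {Q : Type*} [MulOneClass Q] [ClassThree Q]

theorem associator_mem_secondCenter (a b c : Q) : associator a b c ∈ secondCenter Q := by
  obtain ⟨z, hz, h⟩ := ClassThree.exists_associator a b c
  rwa [associator_eq_iff.2 h]

/-- Associators do not change when the arguments are multiplied by central elements. -/
theorem associator_mul_central {k m n : Q} (hk : IsMulCentral k) (hm : IsMulCentral m)
    (hn : IsMulCentral n) (a b c : Q) :
    associator (a * k) (b * m) (c * n) = associator a b c := by
  rw [associator_eq_iff, hk.mul_mul_mul_comm hm, (Set.mul_mem_center hk hm).mul_mul_mul_comm hn,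
    hm.mul_mul_mul_comm hn, hk.mul_mul_mul_comm (Set.mul_mem_center hm hn), associator_spec a b c,
    hk.left_assoc, (Set.mul_mem_center (Set.mul_mem_center hk hm) hn).right_comm]

theorem exists_inner_eq_mul_central {z : Q} (hz : z ∈ secondCenter Q) (p a : Q) :
    (∃ n, IsMulCentral n ∧ inner p z a = a * n) ∧ ∃ n, IsMulCentral n ∧ inner z p a = a * n := by
  have hz' := mem_secondCenter_iff.1 hz
  have := centralCon_quotient (isCentralSubgroup_center (Q := Q))
  constructor
  · obtain ⟨n, hn, h⟩ := (Con.eq _).1 (hz'.mid_assoc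
      (p : (centralCon _).Quotient) (a : (centralCon _).Quotient))
    exact ⟨n, hn, inner_eq_iff.2 (h.trans (IsMulCentral.right_assoc hn _ _))⟩
  · obtain ⟨n, hn, h⟩ := (Con.eq _).1 (hz'.left_assoc
      (p : (centralCon _).Quotient) (a : (centralCon _).Quotient)).symm
    exact ⟨n, hn, inner_eq_iff.2 (h.trans (IsMulCentral.right_assoc hn _ _))⟩

/-- The associator as a stable element. It is stable because the inner mappings in question are
automorphisms that move the arguments of the associator by central factors only. -/
noncomputable def assoc (a b c : Q) : Stable Q :=
  ⟨associator a b c, associator_mem_secondCenter a b c, fun z hz p => by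
    constructor
    · obtain ⟨k, hk, h⟩ := (exists_inner_eq_mul_central hz p a).1
      obtain ⟨m, hm, h'⟩ := (exists_inner_eq_mul_central hz p b).1
      obtain ⟨n, hn, h''⟩ := (exists_inner_eq_mul_central hz p c).1
      have := map_associator (inner p z).toMonoidHom a b c
      simp only [MulEquiv.toMonoidHom_eq_coe, MonoidHom.coe_coe, h, h', h'',
        associator_mul_central hk hm hn] at this
      exact this
    · obtain ⟨k, hk, h⟩ := (exists_inner_eq_mul_central hz p a).2
      obtain ⟨m, hm, h'⟩ := (exists_inner_eq_mul_central hz p b).2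
      obtain ⟨n, hn, h''⟩ := (exists_inner_eq_mul_central hz p c).2
      have := map_associator (inner z p).toMonoidHom a b c
      simp only [MulEquiv.toMonoidHom_eq_coe, MonoidHom.coe_coe, h, h', h'',
        associator_mul_central hk hm hn] at this
      exact this⟩

theorem assoc_spec (a b c : Q) : (a * b) * c = (a * (b * c)) * assoc a b c :=
  associator_spec a b c

theorem assoc_eq {a b c : Q} {w : Stable Q} (h : (a * b) * c = (a * (b * c)) * w) :
    assoc a b c = w :=
  Stable.ext (associator_eq_iff.2 h)

theorem assoc_eq_one_iff {a b c : Q} : assoc a b c = 1 ↔ (a * b) * c = a * (b * c) :=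
  ⟨fun h => by rw [assoc_spec, h, Stable.coe_one, mul_one],
    fun h => assoc_eq (by rw [h, Stable.coe_one, mul_one])⟩

theorem assoc_reverse_eq_inv (a b c : Q) : assoc c b a = (assoc a b c)⁻¹ := by
  refine assoc_eq ?_
  rw [CommAutomorphicLoop.mul_comm c b, CommAutomorphicLoop.mul_comm _ a,
    CommAutomorphicLoop.mul_comm c, CommAutomorphicLoop.mul_comm b a, assoc_spec a b c,
    Stable.mul_coe_mul_coe, mul_inv_cancel, Stable.coe_one, mul_one]

/-- The product of the associators of the three cyclic rotations of a triple is `1`. -/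
theorem assoc_middle_eq (a b c : Q) : assoc a b c = (assoc b c a)⁻¹ * (assoc c a b)⁻¹ := by
  refine assoc_eq ?_
  rw [CommAutomorphicLoop.mul_comm a (b * c), assoc_spec b c a, Stable.mul_coe_mul_coe,
    mul_inv_cancel_left, CommAutomorphicLoop.mul_comm b, assoc_spec c a b, Stable.mul_coe_mul_coe,
    mul_inv_cancel, Stable.coe_one, mul_one, CommAutomorphicLoop.mul_comm c]

open Stable

theorem assoc_left_mem {z : Q} (hz : z ∈ secondCenter Q) (a b : Q) :
    assoc z a b ∈ centralSubgroup Q := by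
  obtain ⟨n, hn, h⟩ := hz a b
  rw [assoc_eq (w := ofCentral n hn) h]
  exact hn

theorem assoc_right_mem {z : Q} (hz : z ∈ secondCenter Q) (a b : Q) :
    assoc a b z ∈ centralSubgroup Q := by
  rw [assoc_reverse_eq_inv z b a]
  exact inv_mem (assoc_left_mem hz b a)

theorem assoc_middle_mem {z : Q} (hz : z ∈ secondCenter Q) (a b : Q) :
    assoc a z b ∈ centralSubgroup Q := by
  rw [assoc_middle_eq]
  exact mul_mem (inv_mem (assoc_left_mem hz b a)) (inv_mem (assoc_right_mem hz b a))

theorem inner_mul_assoc {p q a : Q} (h : assoc p q a ∈ centralSubgroup Q) :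
    inner p q a * assoc p q a = a := by
  apply mul_left_cancel (a := p * q)
  rw [← (mem_centralSubgroup.1 h).right_assoc, mul_inner, ← assoc_spec]

/-- Associators with central values are multiplicative in the third argument, because the inner
mapping attached to the first two is an automorphism. -/
theorem assoc_mul_right {p q a b : Q} (ha : assoc p q a ∈ centralSubgroup Q)
    (hb : assoc p q b ∈ centralSubgroup Q) :
    assoc p q (a * b) = assoc p q a * assoc p q b := by
  refine assoc_eq ?_
  rw [← mul_inner p q (a * b), IsMulCentral.right_assoc (mul_mem ha hb), map_mul, coe_mul,
    ← (mem_centralSubgroup.1 ha).mul_mul_mul_comm hb, inner_mul_assoc ha, inner_mul_assoc hb]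

theorem assoc_mul_left {p q a b : Q} (ha : assoc a p q ∈ centralSubgroup Q)
    (hb : assoc b p q ∈ centralSubgroup Q) :
    assoc (a * b) p q = assoc a p q * assoc b p q := by
  rw [assoc_reverse_eq_inv q p a] at ha ⊢
  rw [assoc_reverse_eq_inv q p b] at hb ⊢
  rw [assoc_reverse_eq_inv q p, assoc_mul_right (inv_mem_iff.1 ha) (inv_mem_iff.1 hb), mul_inv]

theorem assoc_mul_coe_right_of_mem {z : Q} (hz : z ∈ secondCenter Q) (a b c : Q) :
    assoc a (b * c) z = assoc a b z * assoc a c z := by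
  simp only [assoc_middle_eq a _ z]
  rw [assoc_mul_left (assoc_middle_mem hz _ _) (assoc_middle_mem hz _ _),
    assoc_mul_right (assoc_left_mem hz _ _) (assoc_left_mem hz _ _), mul_inv, mul_inv,
    mul_mul_mul_comm]

/-- Multiplying the third argument of an associator by a stable element. This is the pentagon
relation between the five bracketings of `a, b, c, z`. -/
theorem assoc_mul_coe_right (a b c : Q) (z : Stable Q) :
    assoc a b (c * z) = assoc a b c * assoc a b z := by
  have hz := z.mem_secondCenter
  have h1 : assoc (a * b) c z = assoc a c z * assoc b c z :=
    assoc_mul_left (assoc_right_mem hz _ _) (assoc_right_mem hz _ _)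
  have h2 : assoc a (b * c) z = assoc a b z * assoc a c z := assoc_mul_coe_right_of_mem hz a b c
  have h3 : assoc a b (c * z) * assoc (a * b) c z =
      assoc b c z * assoc a (b * c) z * assoc a b c := by
    apply mul_coe_right_cancel (a := a * (b * (c * z)))
    -- Both sides are `((a * b) * c) * z`.
    rw [← mul_coe_mul_coe, ← assoc_spec, ← assoc_spec, assoc_spec a b c, mul_coe_mul_coe,
      mul_comm (assoc a b c), ← mul_coe_mul_coe, assoc_spec a (b * c), assoc_spec b c,
      ← IsMulCentral.right_assoc (assoc_right_mem hz b c), mul_coe_mul_coe, mul_coe_mul_coe,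
      mul_assoc]
  rw [h1, h2] at h3
  have h4 : assoc a b (c * z) * (assoc a c z * assoc b c z) =
      (assoc a b c * assoc a b z) * (assoc a c z * assoc b c z) := by
    rw [h3]
    simp only [mul_comm, mul_left_comm]
  exact mul_right_cancel h4

theorem assoc_mul_coe_left (a b c : Q) (z : Stable Q) :
    assoc (a * z) b c = assoc a b c * assoc (z : Q) b c := by
  rw [assoc_reverse_eq_inv c b (a * z), assoc_mul_coe_right, mul_inv, ← assoc_reverse_eq_inv,
    ← assoc_reverse_eq_inv]

theorem assoc_mul_coe_middle (a b c : Q) (z : Stable Q) :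
    assoc a (b * z) c = assoc a b c * assoc a z c := by
  rw [assoc_middle_eq a (b * z), assoc_mul_coe_left, assoc_mul_coe_right, assoc_middle_eq a b,
    assoc_middle_eq a z, mul_inv, mul_inv, mul_mul_mul_comm]

theorem assoc_coe_left_right (w z : Stable Q) (p : Q) : assoc (w : Q) p z = 1 :=
  assoc_eq_one_iff.2 (inner_eq_self_iff.1 (z.3 w w.2 p).2)

theorem assoc_coe_middle_right (w z : Stable Q) (p : Q) : assoc p w z = 1 :=
  assoc_eq_one_iff.2 (inner_eq_self_iff.1 (z.3 w w.2 p).1)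

theorem assoc_coe_left_middle (w z : Stable Q) (p : Q) : assoc (w : Q) z p = 1 := by
  rw [assoc_reverse_eq_inv p, assoc_coe_middle_right, inv_one]

/-- Associators are additive under multiplication of all arguments by stable elements. -/
theorem assoc_mul_coe (a b c : Q) (u v w : Stable Q) : assoc (a * u) (b * v) (c * w) =
    assoc a b c * (assoc (u : Q) b c * assoc a v c * assoc a b w) := by
  simp only [assoc_mul_coe_left, assoc_mul_coe_middle, assoc_mul_coe_right, assoc_coe_left_right,
    assoc_coe_middle_right, assoc_coe_left_middle, mul_one]
  simp only [mul_comm, mul_left_comm]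

/-- For fixed other arguments, the associator is a homomorphism on the stable elements in its third
argument. -/
noncomputable def assocHomRight (a b : Q) : Stable Q →* Stable Q where
  toFun w := assoc a b w
  map_one' := assoc_eq_one_iff.2 (by rw [coe_one, mul_one, mul_one])
  map_mul' w w' := by rw [coe_mul, assoc_mul_coe_right]

theorem assoc_inv_mul_right {n : Stable Q} (hn : n ∈ centralSubgroup Q) (w : Stable Q) (a b : Q) :
    assoc a b (w⁻¹ * n : Stable Q) = (assoc a b w)⁻¹ := by
  have : assocHomRight a b n = 1 :=
    assoc_eq_one_iff.2 ((mem_centralSubgroup.1 hn).right_assoc a b)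
  have h := map_mul (assocHomRight a b) w⁻¹ n
  rwa [this, mul_one, map_inv] at h

theorem assoc_inv_mul_left {n : Stable Q} (hn : n ∈ centralSubgroup Q) (w : Stable Q) (a b : Q) :
    assoc ((w⁻¹ * n : Stable Q) : Q) a b = (assoc (w : Q) a b)⁻¹ := by
  rw [assoc_reverse_eq_inv b a, assoc_inv_mul_right hn, ← assoc_reverse_eq_inv]

theorem assoc_inv_mul_middle {n : Stable Q} (hn : n ∈ centralSubgroup Q) (w : Stable Q)
    (a b : Q) : assoc a (w⁻¹ * n : Stable Q) b = (assoc a w b)⁻¹ := by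
  rw [assoc_middle_eq, assoc_inv_mul_left hn, assoc_inv_mul_right hn, assoc_middle_eq a, mul_inv]

/-- Up to a central factor, the inner mapping attached to `p` and `q` divides `a` by the associator
of `p, q, a`. -/
theorem exists_inner_eq (p q a : Q) :
    ∃ n ∈ centralSubgroup Q, inner p q a = a * ((assoc p q a)⁻¹ * n : Stable Q) := by
  have hm := assoc_right_mem (assoc p q a).mem_secondCenter (p * q) (inner p q a)
  refine ⟨_, inv_mem hm, ?_⟩
  have h : a = inner p q a * (assoc p q a * assoc (p * q) (inner p q a) (assoc p q a) :
      Stable Q) := by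
    apply mul_left_cancel (a := p * q)
    rw [← mul_coe_mul_coe, ← (mem_centralSubgroup.1 hm).right_assoc, ← assoc_spec, mul_inner,
      ← assoc_spec]
  nth_rw 2 [h]
  rw [mul_coe_mul_coe, ← mul_inv, mul_inv_cancel, coe_one, mul_one]

/-- In class three, `c ↦ (p, q, c)` is a derivation of the associator: this is the condition that
the inner mapping attached to `p` and `q` preserves associators. -/
theorem assoc_assoc (p q a b c : Q) : assoc p q (assoc a b c) =
    assoc (assoc p q a : Q) b c * assoc a (assoc p q b) c * assoc a b (assoc p q c) := by
  obtain ⟨k, hk, ha⟩ := exists_inner_eq p q a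
  obtain ⟨m, hm, hb⟩ := exists_inner_eq p q b
  obtain ⟨n, hn, hc⟩ := exists_inner_eq p q c
  have h1 : inner p q (assoc a b c) = assoc (inner p q a) (inner p q b) (inner p q c) :=
    map_associator (inner p q).toMonoidHom a b c
  rw [ha, hb, hc, assoc_mul_coe, assoc_inv_mul_left hk, assoc_inv_mul_middle hm,
    assoc_inv_mul_right hn] at h1
  have h2 := inner_mul_assoc (assoc_right_mem (assoc a b c).mem_secondCenter p q)
  rw [h1, ← coe_mul] at h2
  have h3 := Stable.ext h2
  rw [mul_assoc, mul_eq_left, mul_eq_one_iff_inv_eq'] at h3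
  rwa [← mul_inv, ← mul_inv, inv_inj] at h3

section TwoGenerators

variable (x y : Q)

theorem assoc_self_eq_one : assoc x y x = 1 := assoc_eq_one_iff.2 (assoc_self x y)

theorem assoc_coe_one_left : assoc ((1 : Stable Q) : Q) x y = 1 :=
  assoc_eq_one_iff.2 (by rw [coe_one, one_mul, one_mul])

theorem assoc_coe_one_middle : assoc x ((1 : Stable Q) : Q) y = 1 :=
  assoc_eq_one_iff.2 (by rw [coe_one, mul_one, one_mul])

/-- The relation `(x, y, u₁) = (x, x, u₂)` for `u₁ = (x, x, y)` and `u₂ = (x, y, y)`. -/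
theorem assoc_assoc_left : assoc x y (assoc x x y) = assoc x x (assoc x y y) := by
  rw [assoc_assoc, assoc_self_eq_one, assoc_coe_one_left, assoc_coe_one_middle, one_mul, one_mul]

theorem assoc_assoc_middle : assoc x (assoc x x y) y = 1 := by
  have h := assoc_assoc x x x y y
  rw [assoc_self_eq_one, assoc_coe_one_left, one_mul, assoc_assoc_left] at h
  exact mul_eq_right.1 h.symm

theorem assoc_inv_right (w : Stable Q) : assoc x y (w⁻¹ : Stable Q) = (assoc x y w)⁻¹ :=
  map_inv (assocHomRight x y) w

/-- The relation `(y, x, u₂) = (y, y, u₁)` for `u₁ = (x, x, y)` and `u₂ = (x, y, y)`. -/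
theorem assoc_assoc_left' : assoc y x (assoc x y y) = assoc y y (assoc x x y) := by
  have h := assoc_assoc_left y x
  rwa [assoc_reverse_eq_inv x y y, assoc_reverse_eq_inv x x y, assoc_inv_right, assoc_inv_right,
    inv_inj] at h

theorem assoc_assoc_middle' : assoc x (assoc x y y) y = 1 := by
  have h := assoc_assoc_middle y x
  have h1 := assoc_inv_mul_middle (one_mem (centralSubgroup Q)) (assoc x y y) y x
  rwa [mul_one, ← assoc_reverse_eq_inv x y y, h, eq_comm, inv_eq_one,
    assoc_reverse_eq_inv x _ y, inv_eq_one] at h1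

end TwoGenerators

end ClassThree

end CommAutomorphicLoop

namespace CommAutomorphicLoop

open IsLoop Stable

/-! ### Canonical words exhaust a two-generated loop of class three -/

section Span

variable {Q : Type*} [MulOneClass Q] [ClassThree Q]

/-- Once the four associators of weight five vanish, `(x, x, y)` and `(x, y, y)` are central. -/
theorem Generates.isMulCentral_map_associator {K : Type*} [MulOneClass K] [CommAutomorphicLoop K]
    {x y : Q} {f : Q →* K} (hf : Generates (f x) (f y))
    (h1 : f (associator x x (associator x x y)) = 1)
    (h2 : f (associator x x (associator x y y)) = 1)
    (h3 : f (associator y y (associator x x y)) = 1)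
    (h4 : f (associator y y (associator x y y)) = 1) :
    IsMulCentral (f (associator x x y)) ∧ IsMulCentral (f (associator x y y)) := by
  have hassoc {a b c : Q} (h : f (associator a b c) = 1) :
      (f a * f b) * f c = f a * (f b * f c) := by
    rwa [map_associator, associator_eq_one_iff] at h
  have hassoc' {a b c : Q} (h : assoc a b c = 1) : (f a * f b) * f c = f a * (f b * f c) :=
    hassoc ((congrArg (fun w : Stable Q => f w) h).trans (map_one f))
  constructor
  · refine hf.isMulCentral (hassoc h1) (hassoc h3) (hassoc ?_)
      (hassoc' (assoc_assoc_middle x y))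
    rw [← h2]
    exact congrArg (fun w : Stable Q => f w) (assoc_assoc_left x y)
  · have h5 := hassoc' (assoc_assoc_middle' x y)
    have h6 : (f y * f x) * f (associator x y y) = f y * (f x * f (associator x y y)) := by
      refine hassoc ?_
      rw [← h3]
      exact congrArg (fun w : Stable Q => f w) (assoc_assoc_left' x y)
    exact hf.isMulCentral (hassoc h2) (hassoc h4)
      (assoc_reverse (assoc_rotate h6 h5)) h5

open scoped Pointwise in
/-- In a loop of class three generated by `x` and `y`, the associators `(x, x, y)` and
`(x, y, y)` become central modulo the central subgroup `N` generated by the associators of weight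
five, and modulo `N` and these two the loop is an abelian group. -/
theorem Generates.exists_canonicalWord {x y : Q} (hxy : Generates x y) (w : Q) :
    ∃ a : IntOctuple, w = canonicalWord x y a := by
  have hcen (a b c d e : Q) : IsMulCentral (associator a b (associator c d e)) :=
    assoc_right_mem (associator_mem_secondCenter c d e) a b
  have hN1 := isCentralSubgroup_power (hcen x x x x y)
  have hN2 := isCentralSubgroup_power (hcen x x x y y)
  have hN3 := isCentralSubgroup_power (hcen y y x x y)
  have hN4 := isCentralSubgroup_power (hcen y y x y y)
  have hN := ((hN1.mul hN2).mul hN3).mul hN4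
  have := centralCon_quotient hN
  set f : Q →* (centralCon hN).Quotient := (centralCon hN).mk'
  have hf : Generates (f x) (f y) := hxy.quotient (centralCon hN)
  have hker {n : Q} (hn : n ∈ Set.range (power (associator x x (associator x x y))) *
      Set.range (power (associator x x (associator x y y))) *
      Set.range (power (associator y y (associator x x y))) *
      Set.range (power (associator y y (associator x y y)))) : f n = 1 := by
    rw [← map_one f]
    exact (Con.eq _).2 ((centralCon hN).symm ⟨n, hn, (one_mul n).symm⟩)
  have hself (v : Q) : v ∈ Set.range (power v) := ⟨1, power_one v⟩
  obtain ⟨hu1, hu2⟩ := hf.isMulCentral_map_associator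
    (hker (by simpa using Set.mul_mem_mul (Set.mul_mem_mul (Set.mul_mem_mul
      (hself _) hN2.one_mem) hN3.one_mem) hN4.one_mem))
    (hker (by simpa using Set.mul_mem_mul (Set.mul_mem_mul (Set.mul_mem_mul
      hN1.one_mem (hself _)) hN3.one_mem) hN4.one_mem))
    (hker (by simpa using Set.mul_mem_mul (Set.mul_mem_mul (Set.mul_mem_mul
      hN1.one_mem hN2.one_mem) (hself _)) hN4.one_mem))
    (hker (by simpa using Set.mul_mem_mul (Set.mul_mem_mul (Set.mul_mem_mul
      hN1.one_mem hN2.one_mem) hN3.one_mem) (hself _)))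
  have hU1 := isCentralSubgroup_power hu1
  have hU2 := isCentralSubgroup_power hu2
  have hU := hU1.mul hU2
  have := centralCon_quotient hU
  set g : (centralCon hN).Quotient →* (centralCon hU).Quotient := (centralCon hU).mk'
  have hg : Generates (g (f x)) (g (f y)) := hf.quotient (centralCon hU)
  have hker' {n : (centralCon hN).Quotient} (hn : n ∈ Set.range (power (f (associator x x y))) *
      Set.range (power (f (associator x y y)))) : g n = 1 := by
    rw [← map_one g]
    exact (Con.eq _).2 ((centralCon hU).symm ⟨n, hn, (one_mul n).symm⟩)
  have hself' (v : (centralCon hN).Quotient) : v ∈ Set.range (power v) := ⟨1, power_one v⟩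
  have h1 := hker' (by simpa using Set.mul_mem_mul (hself' _) hU2.one_mem)
  have h2 := hker' (by simpa using Set.mul_mem_mul hU1.one_mem (hself' _))
  -- The exponents are read off from the three layers in turn.
  obtain ⟨i, j, hij⟩ := hg.exists_power_mul_power (hg.isMulCentral_of_assoc
    (associator_eq_one_iff.1 ((map_associator (g.comp f) x x y).symm.trans h1))
    (associator_eq_one_iff.1 ((map_associator (g.comp f) x y y).symm.trans h2))) (g (f w))
  rw [← map_power, ← map_power, ← map_power, ← map_power, ← map_mul, ← map_mul] at hij
  obtain ⟨_, ⟨_, ⟨k, rfl⟩, _, ⟨l, rfl⟩, rfl⟩, hkl⟩ := (Con.eq (centralCon hU)).1 hij.symm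
  simp only [← map_power, ← map_mul] at hkl
  obtain ⟨_, ⟨_, ⟨_, ⟨_, ⟨m, rfl⟩, _, ⟨n, rfl⟩, rfl⟩, _, ⟨p, rfl⟩, rfl⟩, _, ⟨q, rfl⟩, rfl⟩, h⟩ :=
    (Con.eq (centralCon hN)).1 hkl.symm
  exact ⟨⟨i, j, k, l, m, n, p, q⟩, h⟩

end Span

end CommAutomorphicLoop

/-! ### Inner mappings and the upper central series -/

namespace CommAutomorphicLoop

open IsLoop

section InnerMappings

variable {Q : Type*} [MulOneClass Q]

/-- The mappings `c ↦ (a * b) \ (a * (b * c))` belong to the inner mapping group. -/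
theorem of_isCommAutomorphicLoop (h : IsCommAutomorphicLoop Q) : CommAutomorphicLoop Q := by
  have := h.isLoop
  have hL (a : Q) : leftTranslation a ∈ multiplicationGroup Q :=
    Subgroup.subset_closure (Or.inl ⟨a, fun _ => rfl⟩)
  refine { h.isLoop with mul_comm' := h.comm, inner_mul' := fun a b c d s t hs ht => ?_ }
  set φ : Equiv.Perm Q := (leftTranslation (a * b))⁻¹ * (leftTranslation a * leftTranslation b)
  have hφ (e : Q) : (a * b) * φ e = a * (b * e) :=
    (leftTranslation (a * b)).apply_symm_apply (a * (b * e))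
  have hmem : φ ∈ innerMappingGroup Q := by
    refine ⟨Subgroup.mul_mem _ (Subgroup.inv_mem _ (hL _)) (Subgroup.mul_mem _ (hL _) (hL _)), ?_⟩
    change φ 1 = 1
    apply mul_left_cancel (a := a * b)
    rw [hφ, mul_one, mul_one]
  rw [mul_left_cancel (hs.trans (hφ c).symm), mul_left_cancel (ht.trans (hφ d).symm),
    ← h.automorphic φ hmem, hφ]

/-- In a commutative automorphic loop, every element of the multiplication group is an automorphism
followed by a translation. -/
theorem exists_eq_mul_of_mem_multiplicationGroup [CommAutomorphicLoop Q] {σ : Equiv.Perm Q}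
    (hσ : σ ∈ multiplicationGroup Q) : ∃ (c : Q) (φ : Q ≃* Q), ∀ b, σ b = c * φ b := by
  induction hσ using Subgroup.closure_induction with
  | mem σ h =>
    obtain ⟨a, h⟩ | ⟨a, h⟩ := h
    · exact ⟨a, MulEquiv.refl Q, h⟩
    · exact ⟨a, MulEquiv.refl Q, fun b => (h b).trans (CommAutomorphicLoop.mul_comm b a)⟩
  | one => exact ⟨1, MulEquiv.refl Q, fun b => (one_mul b).symm⟩
  | mul σ τ _ _ h h' =>
    obtain ⟨c, φ, h⟩ := h
    obtain ⟨d, ψ, h'⟩ := h'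
    refine ⟨c * φ d, (ψ.trans φ).trans (inner c (φ d)), fun b => ?_⟩
    rw [Equiv.Perm.mul_apply, h', h, map_mul]
    exact (mul_inner c (φ d) (φ (ψ b))).symm
  | inv σ _ h =>
    obtain ⟨c, φ, h⟩ := h
    refine ⟨φ.symm (ldiv c 1), (inner c (ldiv c 1)).symm.trans φ.symm, fun b => ?_⟩
    rw [Equiv.Perm.inv_eq_iff_eq, h, MulEquiv.trans_apply, ← map_mul, MulEquiv.apply_symm_apply,
      ← mul_inner, mul_ldiv, one_mul, MulEquiv.apply_symm_apply]

/-- An inner mapping fixes `1`, so in its decomposition into an automorphism and a translation the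
latter is trivial. -/
theorem isCommAutomorphicLoop [CommAutomorphicLoop Q] : IsCommAutomorphicLoop Q where
  isLoop := inferInstance
  comm := CommAutomorphicLoop.mul_comm
  automorphic σ hσ a b := by
    obtain ⟨c, φ, h⟩ := exists_eq_mul_of_mem_multiplicationGroup hσ.1
    have h1 : σ 1 = 1 := hσ.2
    obtain rfl : c = 1 := by rw [← h1, h, map_one, mul_one]
    simp only [h, one_mul, map_mul]

end InnerMappings

end CommAutomorphicLoop

namespace IsLoop

open CommAutomorphicLoop

section UpperCentral

variable {Q : Type*} [MulOneClass Q]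

theorem cosetCon_rel {N : Set Q} {a n : Q} (hn : n ∈ N) : cosetCon N a (a * n) :=
  ConGen.Rel.of _ _ ⟨n, hn, rfl⟩

/-- Membership in the upper central series needs no description of the congruences that define it:
the generating pairs suffice. -/
theorem mem_upperCentral_succ (hcomm : ∀ a b : Q, a * b = b * a) {i : ℕ} {z : Q}
    (h : ∀ a b : Q, ∃ n ∈ upperCentral Q i, (z * a) * b = (z * (a * b)) * n) :
    z ∈ upperCentral Q (i + 1) := by
  change (z : (cosetCon (upperCentral Q i)).Quotient) ∈
    Set.center (cosetCon (upperCentral Q i)).Quotient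
  have hcomm' (a b : (cosetCon (upperCentral Q i)).Quotient) : a * b = b * a := by
    induction a, b using Con.induction_on₂ with | _ a b
    rw [← Con.coe_mul, hcomm, Con.coe_mul]
  have hleft (a b : (cosetCon (upperCentral Q i)).Quotient) : z * (a * b) = (z * a) * b := by
    induction a, b using Con.induction_on₂ with | _ a b
    obtain ⟨n, hn, h⟩ := h a b
    refine (Con.eq _).2 ?_
    change cosetCon _ (z * (a * b)) ((z * a) * b)
    rw [h]
    exact cosetCon_rel hn
  refine ⟨hcomm' z, hleft, fun a b => ?_⟩
  rw [hcomm' _ (z : (cosetCon _).Quotient), hcomm' a b, hleft, hcomm' z b, hcomm' a]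

theorem eq_of_cosetCon_upperCentral_zero {a b : Q} (h : cosetCon (upperCentral Q 0) a b) :
    a = b := by
  have : cosetCon (upperCentral Q 0) ≤ (⊥ : Con Q) := by
    refine Con.conGen_le.2 ?_
    rintro a _ ⟨n, hn, rfl⟩
    obtain rfl : n = 1 := hn
    exact (mul_one a).symm
  exact this h

/-- The congruence modulo the `i + 1`-st center is equality up to a factor from the `i + 1`-st
center, modulo the `i`-th center. -/
theorem exists_of_cosetCon_upperCentral_succ [IsLoop Q] {i : ℕ} {a b : Q}
    (h : cosetCon (upperCentral Q (i + 1)) a b) :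
    ∃ n ∈ upperCentral Q (i + 1), cosetCon (upperCentral Q i) b (a * n) := by
  set c := cosetCon (upperCentral Q i)
  have hN : IsCentralSubgroup (Set.center c.Quotient) :=
    { isMulCentral := fun _ h => h
      one_mem := Set.one_mem_center
      mul_mem := fun _ hm _ hn => Set.mul_mem_center hm hn
      exists_inv := fun n hn => by
        induction n using Con.induction_on with | _ n
        have h : (n : c.Quotient) * (ldiv n 1 : Q) = 1 := congrArg _ (mul_ldiv n 1)
        exact ⟨_, IsMulCentral.of_mul_eq_one hn h, h⟩ }
  have hle : cosetCon (upperCentral Q (i + 1)) ≤ (centralCon hN).comap c.mk' (map_mul c.mk') := by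
    refine Con.conGen_le.2 ?_
    rintro a _ ⟨n, hn, rfl⟩
    exact ⟨n, hn, rfl⟩
  obtain ⟨n, hn, h⟩ := hle h
  induction n using Con.induction_on with | _ n
  exact ⟨n, hn, (Con.eq c).1 h⟩

theorem isMulCentral_of_mem_upperCentral_one {n : Q} (hn : n ∈ upperCentral Q 1) :
    IsMulCentral n := by
  have hn' : IsMulCentral (n : (cosetCon (upperCentral Q 0)).Quotient) := hn
  exact ⟨fun a => eq_of_cosetCon_upperCentral_zero ((Con.eq _).1 (hn'.comm a)),
    fun a b => eq_of_cosetCon_upperCentral_zero ((Con.eq _).1 (hn'.left_assoc a b)),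
    fun a b => eq_of_cosetCon_upperCentral_zero ((Con.eq _).1 (hn'.right_assoc a b))⟩

theorem exists_of_cosetCon_upperCentral_one [IsLoop Q] {a b : Q}
    (h : cosetCon (upperCentral Q 1) a b) : ∃ n, IsMulCentral n ∧ b = a * n := by
  obtain ⟨n, hn, h⟩ := exists_of_cosetCon_upperCentral_succ h
  exact ⟨n, isMulCentral_of_mem_upperCentral_one hn, eq_of_cosetCon_upperCentral_zero h⟩

theorem mem_secondCenter_of_mem_upperCentral_two [IsLoop Q] {z : Q}
    (hz : z ∈ upperCentral Q 2) : z ∈ secondCenter Q := fun a b => by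
  have hz' : IsMulCentral (z : (cosetCon (upperCentral Q 1)).Quotient) := hz
  exact exists_of_cosetCon_upperCentral_one ((Con.eq _).1 (hz'.left_assoc a b))

end UpperCentral

end IsLoop

namespace CommAutomorphicLoop

open IsLoop

theorem classThree_of_upperCentral_eq_univ {Q : Type*} [MulOneClass Q] [CommAutomorphicLoop Q]
    (h : upperCentral Q 3 = Set.univ) : ClassThree Q where
  exists_associator a b c := by
    have ha : a ∈ upperCentral Q 3 := h ▸ Set.mem_univ a
    have ha' : IsMulCentral (a : (cosetCon (upperCentral Q 2)).Quotient) := ha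
    obtain ⟨n, hn, h1⟩ := exists_of_cosetCon_upperCentral_succ
      ((Con.eq _).1 (ha'.left_assoc b c))
    obtain ⟨m, hm, h2⟩ := exists_of_cosetCon_upperCentral_one (Con.symm _ h1)
    exact ⟨n * m, mul_mem_secondCenter (mem_secondCenter_of_mem_upperCentral_two hn)
      (isMulCentral_mem_secondCenter hm), h2.trans (hm.right_assoc _ n)⟩

theorem upperCentral_eq_univ {Q : Type*} [MulOneClass Q] [ClassThree Q] :
    upperCentral Q 3 = Set.univ := by
  have hcomm := CommAutomorphicLoop.mul_comm (Q := Q)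
  have h1 {n : Q} (hn : IsMulCentral n) : n ∈ upperCentral Q 1 :=
    mem_upperCentral_succ hcomm fun a b => ⟨1, rfl, by rw [mul_one, hn.left_assoc]⟩
  have h2 {z : Q} (hz : z ∈ secondCenter Q) : z ∈ upperCentral Q 2 :=
    mem_upperCentral_succ hcomm fun a b => by
      obtain ⟨n, hn, h⟩ := hz a b
      exact ⟨n, h1 hn, h⟩
  refine Set.eq_univ_of_forall fun a => mem_upperCentral_succ hcomm fun b c => ?_
  obtain ⟨z, hz, h⟩ := ClassThree.exists_associator a b c
  exact ⟨z, h2 hz, h⟩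

/-! ### Products and subloops -/

section Product

variable {Q R : Type*} [MulOneClass Q] [MulOneClass R]

instance [CommAutomorphicLoop Q] [CommAutomorphicLoop R] : CommAutomorphicLoop (Q × R) where
  toIsLoop := by
    refine IsLoop.of_comm (fun a b => Prod.ext (CommAutomorphicLoop.mul_comm _ _)
      (CommAutomorphicLoop.mul_comm _ _)) fun a => ⟨fun b c h => ?_, fun b => ?_⟩
    · exact Prod.ext (mul_left_cancel (congrArg Prod.fst h)) (mul_left_cancel (congrArg Prod.snd h))
    · exact ⟨(ldiv a.1 b.1, ldiv a.2 b.2), Prod.ext (mul_ldiv _ _) (mul_ldiv _ _)⟩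
  mul_comm' a b := Prod.ext (CommAutomorphicLoop.mul_comm _ _) (CommAutomorphicLoop.mul_comm _ _)
  inner_mul' a b c d s t hs ht := Prod.ext
    (inner_mul' _ _ _ _ _ _ (congrArg Prod.fst hs) (congrArg Prod.fst ht))
    (inner_mul' _ _ _ _ _ _ (congrArg Prod.snd hs) (congrArg Prod.snd ht))

theorem mk_mem_secondCenter {z : Q} {w : R} (hz : z ∈ secondCenter Q) (hw : w ∈ secondCenter R) :
    (z, w) ∈ secondCenter (Q × R) := fun a b => by
  obtain ⟨n, hn, h⟩ := hz a.1 b.1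
  obtain ⟨m, hm, h'⟩ := hw a.2 b.2
  exact ⟨(n, m), by rw [Set.center_prod]; exact ⟨hn, hm⟩, Prod.ext h h'⟩

instance [ClassThree Q] [ClassThree R] : ClassThree (Q × R) where
  exists_associator a b c := by
    obtain ⟨z, hz, h⟩ := ClassThree.exists_associator a.1 b.1 c.1
    obtain ⟨w, hw, h'⟩ := ClassThree.exists_associator a.2 b.2 c.2
    exact ⟨(z, w), mk_mem_secondCenter hz hw, Prod.ext h h'⟩

end Product

section Equiv

variable {Q R : Type*} [MulOneClass Q] [MulOneClass R]

theorem of_mulEquiv [CommAutomorphicLoop R] (e : Q ≃* R) : CommAutomorphicLoop Q where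
  toIsLoop := by
    refine IsLoop.of_comm (fun a b => e.injective ?_) fun a => ⟨fun b c h => e.injective ?_,
      fun b => ⟨e.symm (ldiv (e a) (e b)), e.injective ?_⟩⟩
    · rw [map_mul, map_mul, CommAutomorphicLoop.mul_comm]
    · apply mul_left_cancel (a := e a)
      rw [← map_mul, ← map_mul]
      exact congrArg e h
    · simp
  mul_comm' a b := e.injective (by rw [map_mul, map_mul, CommAutomorphicLoop.mul_comm])
  inner_mul' a b c d s t hs ht := by
    have hs' := congrArg e hs
    have ht' := congrArg e ht
    apply e.injective
    simp only [map_mul] at hs' ht' ⊢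
    exact inner_mul' _ _ _ _ _ _ hs' ht'

theorem classThree_of_mulEquiv [ClassThree R] (e : Q ≃* R) : ClassThree Q where
  toCommAutomorphicLoop := of_mulEquiv e
  exists_associator a b c := by
    obtain ⟨z, hz, h⟩ := ClassThree.exists_associator (e a) (e b) (e c)
    refine ⟨e.symm z, fun p q => ?_, e.injective (by simpa using h)⟩
    obtain ⟨n, hn, h'⟩ := hz (e p) (e q)
    exact ⟨e.symm n, (MulEquivClass.apply_mem_center_iff e.symm).2 hn,
      e.injective (by simpa using h')⟩

end Equiv

section Subloop

variable {Q : Type*} [MulOneClass Q]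

/-- The subloop generated by two elements. -/
def closurePair [IsLoop Q] (x y : Q) : Submonoid Q where
  carrier := {a | ∀ S : Set Q, x ∈ S → y ∈ S → (∀ a ∈ S, ∀ b ∈ S, a * b ∈ S) →
    (∀ a ∈ S, ∀ b ∈ S, ldiv a b ∈ S) → a ∈ S}
  one_mem' S hx _ _ hd := by
    rw [← ldiv_mul x 1, mul_one]
    exact hd x hx x hx
  mul_mem' ha hb S hx hy hm hd := hm _ (ha S hx hy hm hd) _ (hb S hx hy hm hd)

section Loop

variable [IsLoop Q] (x y : Q)

theorem left_mem_closurePair : x ∈ closurePair x y := fun _ hx _ _ _ => hx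

theorem right_mem_closurePair : y ∈ closurePair x y := fun _ _ hy _ _ => hy

variable {x y}

theorem ldiv_mem_closurePair {a b : Q} (ha : a ∈ closurePair x y) (hb : b ∈ closurePair x y) :
    ldiv a b ∈ closurePair x y :=
  fun S hx hy hm hd => hd _ (ha S hx hy hm hd) _ (hb S hx hy hm hd)

end Loop

instance [CommAutomorphicLoop Q] (x y : Q) : CommAutomorphicLoop (closurePair x y) where
  toIsLoop := by
    refine IsLoop.of_comm (fun a b => Subtype.ext (CommAutomorphicLoop.mul_comm _ _))
      fun a => ⟨fun b c h => ?_, fun b => ?_⟩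
    · exact Subtype.ext (mul_left_cancel (congrArg Subtype.val h))
    · exact ⟨⟨ldiv (a : Q) b, ldiv_mem_closurePair a.2 b.2⟩, Subtype.ext (mul_ldiv _ _)⟩
  mul_comm' a b := Subtype.ext (CommAutomorphicLoop.mul_comm _ _)
  inner_mul' a b c d s t hs ht := Subtype.ext
    (inner_mul' _ _ _ _ _ _ (congrArg Subtype.val hs) (congrArg Subtype.val ht))

theorem generates_closurePair [CommAutomorphicLoop Q] (x y : Q) :
    Generates (Q := closurePair x y) ⟨x, left_mem_closurePair x y⟩
      ⟨y, right_mem_closurePair x y⟩ := by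
  intro S hx hy hm hd a
  obtain ⟨_, h⟩ := a.2 {b | ∃ h : b ∈ closurePair x y, ⟨b, h⟩ ∈ S} ⟨_, hx⟩ ⟨_, hy⟩
    (fun a ⟨ha, ha'⟩ b ⟨hb, hb'⟩ => ⟨mul_mem ha hb, hm _ ha' _ hb'⟩)
    (fun a ⟨ha, ha'⟩ b ⟨hb, hb'⟩ => ⟨ldiv_mem_closurePair ha hb, by
      have h := hd _ ha' _ hb'
      have h' := map_ldiv (closurePair x y).subtype ⟨a, ha⟩ ⟨b, hb⟩
      rwa [← show _ = (⟨ldiv a b, _⟩ : closurePair x y) from Subtype.ext h']⟩)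
  exact h

theorem mk_mem_secondCenter_closurePair [CommAutomorphicLoop Q] {x y z : Q}
    (hz : z ∈ secondCenter Q) (h : z ∈ closurePair x y) :
    (⟨z, h⟩ : closurePair x y) ∈ secondCenter (closurePair x y) := fun a b => by
  obtain ⟨n, hn, h'⟩ := hz a b
  have hn' : n ∈ closurePair x y := by
    rw [← ldiv_mul (z * (a * b : Q)) n, ← h']
    exact ldiv_mem_closurePair (mul_mem h (mul_mem a.2 b.2)) (mul_mem (mul_mem h a.2) b.2)
  refine ⟨⟨n, hn'⟩, isMulCentral_of_left_assoc fun a b => ?_, Subtype.ext h'⟩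
  exact Subtype.ext (IsMulCentral.left_assoc hn (a : Q) b)

instance [ClassThree Q] (x y : Q) : ClassThree (closurePair x y) where
  exists_associator a b c := by
    refine ⟨⟨associator (a : Q) b c, ?_⟩,
      mk_mem_secondCenter_closurePair (associator_mem_secondCenter _ _ _) _,
      Subtype.ext (associator_spec (a : Q) b c)⟩
    exact ldiv_mem_closurePair (mul_mem a.2 (mul_mem b.2 c.2)) (mul_mem (mul_mem a.2 b.2) c.2)

end Subloop

end CommAutomorphicLoop

/-! ### The loop of octuples -/

namespace IntOctuple

open IsLoop CommAutomorphicLoop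

theorem β_zero : β 0 = 0 := rfl

theorem mul_left_bijective (a : IntOctuple) : Function.Bijective fun b : IntOctuple => a * b := by
  constructor
  · rintro ⟨b1, b2, b3, b4, b5, b6, b7, b8⟩ ⟨c1, c2, c3, c4, c5, c6, c7, c8⟩ h
    simp only [mul_def, mul, mk.injEq] at h
    obtain ⟨h1, h2, h3, h4, h5, h6, h7, h8⟩ := h
    obtain rfl := add_left_cancel h1
    obtain rfl := add_left_cancel h2
    obtain rfl : b3 = c3 := by linarith
    obtain rfl : b4 = c4 := by linarith
    obtain rfl : b5 = c5 := by linarith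
    obtain rfl : b6 = c6 := by linarith
    obtain rfl : b7 = c7 := by linarith
    obtain rfl : b8 = c8 := by linarith
    rfl
  · intro c
    -- The first four coordinates are found successively; the last four only enter additively.
    let b : IntOctuple := ⟨c.a1 - a.a1, c.a2 - a.a2, c.a3 - a.a3 + a.a1 * (c.a1 - a.a1) * c.a2,
      c.a4 - a.a4 - a.a2 * (c.a2 - a.a2) * c.a1, 0, 0, 0, 0⟩
    refine ⟨{ b with
      a5 := c.a5 - (mul a b).a5
      a6 := c.a6 - (mul a b).a6
      a7 := c.a7 - (mul a b).a7
      a8 := c.a8 - (mul a b).a8 }, ?_⟩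
    ext <;> simp only [mul_def, mul, b] <;> ring

instance : CommAutomorphicLoop IntOctuple where
  toIsLoop := IsLoop.of_comm mul_comm' mul_left_bijective
  mul_comm' := mul_comm'
  inner_mul' a b c d s t hs ht := by
    have hcancel {s c : IntOctuple} (h : (a * b) * s = a * (b * c)) : s = innerMap a b c :=
      (mul_left_bijective (a * b)).1 (h.trans (mul_innerMap a b c).symm)
    rw [hcancel hs, hcancel ht, ← innerMap_mul, mul_innerMap]

/-- The product of any octuple with one that starts with two zeros is the sum. -/
theorem mul_eq_add (a : IntOctuple) (c3 c4 c5 c6 c7 c8 : ℤ) :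
    a * ⟨0, 0, c3, c4, c5, c6, c7, c8⟩ =
      ⟨a.a1, a.a2, a.a3 + c3, a.a4 + c4, a.a5 + c5, a.a6 + c6, a.a7 + c7, a.a8 + c8⟩ := by
  ext <;> simp [mul_def, mul, β_zero]

theorem eq_mul_sub {a b : IntOctuple} (h1 : b.a1 = a.a1) (h2 : b.a2 = a.a2) :
    b = a * ⟨0, 0, b.a3 - a.a3, b.a4 - a.a4, b.a5 - a.a5, b.a6 - a.a6, b.a7 - a.a7,
      b.a8 - a.a8⟩ := by
  rw [mul_eq_add]
  ext <;> simp [h1, h2]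

theorem isMulCentral_of_zero (c5 c6 c7 c8 : ℤ) :
    IsMulCentral (⟨0, 0, 0, 0, c5, c6, c7, c8⟩ : IntOctuple) := by
  refine isMulCentral_of_left_assoc fun a b => ?_
  rw [mul_comm' _ a, mul_comm' _ (a * b), mul_eq_add, mul_eq_add]
  ext <;> simp only [mul_def, mul] <;> ring

theorem mem_secondCenter_of_zero (c3 c4 c5 c6 c7 c8 : ℤ) :
    (⟨0, 0, c3, c4, c5, c6, c7, c8⟩ : IntOctuple) ∈ secondCenter IntOctuple := by
  intro a b
  set z : IntOctuple := ⟨0, 0, c3, c4, c5, c6, c7, c8⟩ with hz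
  have h3 : ((z * a) * b).a3 = (z * (a * b)).a3 := by
    simp only [mul_def, mul, hz]
    ring
  have h4 : ((z * a) * b).a4 = (z * (a * b)).a4 := by
    simp only [mul_def, mul, hz]
    ring
  refine ⟨_, ?_, eq_mul_sub (add_assoc z.a1 a.a1 b.a1) (add_assoc z.a2 a.a2 b.a2)⟩
  rw [h3, h4, sub_self, sub_self]
  exact isMulCentral_of_zero _ _ _ _

instance : ClassThree IntOctuple where
  exists_associator a b c := ⟨_, mem_secondCenter_of_zero _ _ _ _ _ _,
    eq_mul_sub (add_assoc a.a1 b.a1 c.a1) (add_assoc a.a2 b.a2 c.a2)⟩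

/-- The associator `(e₁, e₁, e₂)` is not central, because it does not associate with `e₁, e₁`. -/
theorem upperCentral_two_ne : upperCentral IntOctuple 2 ≠ Set.univ := by
  intro h
  have h1 : e1 ∈ upperCentral IntOctuple 2 := h ▸ Set.mem_univ e1
  obtain ⟨n, hn, h1⟩ := mem_secondCenter_of_mem_upperCentral_two h1 e1 e2
  have h2 : (e1 * e1) * e2 = (e1 * (e1 * e2)) * ⟨0, 0, 1, 0, 0, 0, 0, 0⟩ := by
    rw [mul_eq_add]
    ext <;> simp [mul_def, mul, e1, e2, α, β]
  obtain rfl := mul_left_cancel (h2.symm.trans h1)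
  have h3 := congrArg a5 (IsMulCentral.right_assoc hn e1 e1)
  simp [mul_def, mul, e1, α, β] at h3

/-! ### Canonical words of octuples -/

theorem power_e1 (n : ℤ) : power e1 n = ⟨n, 0, 0, 0, 0, 0, 0, 0⟩ := by
  refine power_eq_of_add_one (p := fun n : ℤ => (⟨n, 0, 0, 0, 0, 0, 0, 0⟩ : IntOctuple)) rfl
    (fun n => ?_) n
  ext <;> simp [mul_def, mul, e1, β_zero, add_comm]

theorem power_e2 (n : ℤ) : power e2 n = ⟨0, n, 0, 0, 0, 0, 0, 0⟩ := by
  refine power_eq_of_add_one (p := fun n : ℤ => (⟨0, n, 0, 0, 0, 0, 0, 0⟩ : IntOctuple)) rfl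
    (fun n => ?_) n
  ext <;> simp [mul_def, mul, e2, β_zero, add_comm]

theorem power_of_zero (c3 c4 c5 c6 c7 c8 n : ℤ) :
    power (⟨0, 0, c3, c4, c5, c6, c7, c8⟩ : IntOctuple) n =
      ⟨0, 0, n * c3, n * c4, n * c5, n * c6, n * c7, n * c8⟩ := by
  refine power_eq_of_add_one (p := fun n : ℤ =>
    (⟨0, 0, n * c3, n * c4, n * c5, n * c6, n * c7, n * c8⟩ : IntOctuple))
    (by simp [one_def]) (fun n => ?_) n
  rw [mul_eq_add]
  ext <;> simp only <;> ring

theorem canonicalWord_e1_e2 (n : IntOctuple) : canonicalWord e1 e2 n = n := by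
  have hu1 : associator e1 e1 e2 = ⟨0, 0, 1, 0, 0, 0, 0, 0⟩ := associator_eq_iff.2 (by
    rw [mul_eq_add]; ext <;> simp [mul_def, mul, e1, e2, α, β])
  have hu2 : associator e1 e2 e2 = ⟨0, 0, 0, 1, 0, 0, 0, 0⟩ := associator_eq_iff.2 (by
    rw [mul_eq_add]; ext <;> simp [mul_def, mul, e1, e2, α, β])
  have hv1 : associator e1 e1 ⟨0, 0, 1, 0, 0, 0, 0, 0⟩ = ⟨0, 0, 0, 0, 1, 0, 0, 0⟩ :=
    associator_eq_iff.2 (by simp only [mul_eq_add]; ext <;> simp [mul_def, mul, e1, α, β])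
  have hv2 : associator e1 e1 ⟨0, 0, 0, 1, 0, 0, 0, 0⟩ = ⟨0, 0, 0, 0, 0, 1, 0, 0⟩ :=
    associator_eq_iff.2 (by simp only [mul_eq_add]; ext <;> simp [mul_def, mul, e1, α, β])
  have hv3 : associator e2 e2 ⟨0, 0, 1, 0, 0, 0, 0, 0⟩ = ⟨0, 0, 0, 0, 0, 0, 1, 0⟩ :=
    associator_eq_iff.2 (by simp only [mul_eq_add]; ext <;> simp [mul_def, mul, e2, α, β])
  have hv4 : associator e2 e2 ⟨0, 0, 0, 1, 0, 0, 0, 0⟩ = ⟨0, 0, 0, 0, 0, 0, 0, 1⟩ :=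
    associator_eq_iff.2 (by simp only [mul_eq_add]; ext <;> simp [mul_def, mul, e2, α, β])
  simp only [canonicalWord, hu1, hu2, hv1, hv2, hv3, hv4, power_e1, power_e2, power_of_zero,
    mul_eq_add]
  ext <;> simp [mul_def, mul, β_zero]

/-! ### The universal property -/

section Lift

variable {L : Type*} [MulOneClass L] [ClassThree L]

/-- In a loop of class three, canonical words multiply like octuples. The subloop of
`IntOctuple × L` generated by `(e₁, a)` and `(e₂, b)` consists of canonical words in these two
elements, and the canonical word with exponents `n` has first component `n`. So this subloop is the
graph of `canonicalWord a b`. -/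
theorem canonicalWord_mul (a b : L) (m n : IntOctuple) :
    canonicalWord a b (m * n) = canonicalWord a b m * canonicalWord a b n := by
  set x : IntOctuple × L := (e1, a)
  set y : IntOctuple × L := (e2, b)
  obtain ⟨k, hk⟩ := (generates_closurePair x y).exists_canonicalWord
    (canonicalWord ⟨x, left_mem_closurePair x y⟩ ⟨y, right_mem_closurePair x y⟩ m *
      canonicalWord ⟨x, left_mem_closurePair x y⟩ ⟨y, right_mem_closurePair x y⟩ n)
  have h1 := congrArg ((MonoidHom.fst IntOctuple L).comp (closurePair x y).subtype) hk
  have h2 := congrArg ((MonoidHom.snd IntOctuple L).comp (closurePair x y).subtype) hk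
  rw [map_mul, map_canonicalWord, map_canonicalWord, map_canonicalWord] at h1 h2
  have h3 : canonicalWord e1 e2 m * canonicalWord e1 e2 n = canonicalWord e1 e2 k := h1
  rw [canonicalWord_e1_e2, canonicalWord_e1_e2, canonicalWord_e1_e2] at h3
  rw [h3]
  exact h2.symm

/-- The homomorphism from the octuples to a loop of class three that sends `e₁` to `a` and `e₂` to
`b`. -/
noncomputable def lift (a b : L) : IntOctuple →* L where
  toFun := canonicalWord a b
  map_one' := by simp [canonicalWord, one_def]
  map_mul' := canonicalWord_mul a b

theorem lift_apply (a b : L) (n : IntOctuple) : lift a b n = canonicalWord a b n := rfl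

theorem lift_e1 (a b : L) : lift a b e1 = a := by
  simp [lift_apply, canonicalWord, e1]

theorem lift_e2 (a b : L) : lift a b e2 = b := by
  simp [lift_apply, canonicalWord, e2]

end Lift

theorem isFreeCommAutomorphicLoop : IsFreeCommAutomorphicLoop.{0, v} 3 IntOctuple e1 e2 where
  isCommAutomorphicLoop := isCommAutomorphicLoop
  nilpotent := upperCentral_eq_univ
  existsUnique_hom L _ hL h3 a b := by
    have := of_isCommAutomorphicLoop hL
    have := classThree_of_upperCentral_eq_univ h3
    refine ⟨lift a b, ⟨lift_e1 a b, lift_e2 a b⟩, ?_⟩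
    rintro f ⟨rfl, rfl⟩
    ext n
    rw [lift_apply, ← map_canonicalWord, canonicalWord_e1_e2]

end IntOctuple

open IsLoop CommAutomorphicLoop IntOctuple in
/-- Every free loop is isomorphic to the loop of octuples. -/
theorem IsFreeCommAutomorphicLoop.exists_mulEquiv {F : Type u} [MulOneClass F] [IsLoop F] {x y : F}
    (hF : IsFreeCommAutomorphicLoop.{u, u} 3 F x y) :
    ∃ φ : F ≃* IntOctuple, ∀ a : IntOctuple, φ (canonicalWord x y a) = a := by
  have := of_isCommAutomorphicLoop hF.isCommAutomorphicLoop
  have := classThree_of_upperCentral_eq_univ hF.nilpotent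
  -- The universal property of `F` only concerns loops in the universe of `F`.
  have : ClassThree (ULift.{u} IntOctuple) := classThree_of_mulEquiv MulEquiv.ulift
  obtain ⟨f, ⟨hfx, hfy⟩, -⟩ := hF.existsUnique_hom (ULift.{u} IntOctuple)
    CommAutomorphicLoop.isCommAutomorphicLoop upperCentral_eq_univ ⟨e1⟩ ⟨e2⟩
  set g : F →* IntOctuple := MulEquiv.ulift.toMonoidHom.comp f
  have hgx : g x = e1 := congrArg ULift.down hfx
  have hgy : g y = e2 := congrArg ULift.down hfy
  have hg (n : IntOctuple) : g (canonicalWord x y n) = n := by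
    rw [map_canonicalWord, hgx, hgy, canonicalWord_e1_e2]
  have hlift : (lift x y).comp g = MonoidHom.id F := by
    refine (hF.existsUnique_hom F hF.isCommAutomorphicLoop hF.nilpotent x y).unique
      ⟨?_, ?_⟩ ⟨rfl, rfl⟩
    · exact (congrArg _ hgx).trans (lift_e1 x y)
    · exact (congrArg _ hgy).trans (lift_e2 x y)
  have hinj : Function.LeftInverse (lift x y) g := fun w => DFunLike.congr_fun hlift w
  have hsurj : Function.RightInverse (canonicalWord x y) g := hg
  exact ⟨MulEquiv.ofBijective g ⟨hinj.injective, hsurj.surjective⟩, hg⟩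

theorem theorem4p5 :
    -- `(ℤ⁸, *)` is free on `e₁`, `e₂` and has nilpotency class exactly `3`;
    -- in particular the free loop exists
    (IsFreeCommAutomorphicLoop.{0, v} 3 IntOctuple IntOctuple.e1 IntOctuple.e2 ∧
      IsLoop.upperCentral IntOctuple 2 ≠ Set.univ) ∧
    -- every free loop `F` on `x`, `y` has unique canonical forms, and taking exponents is an
    -- isomorphism onto `(ℤ⁸, *)`
    ∀ (F : Type u) [MulOneClass F] [IsLoop F] (x y : F),
      IsFreeCommAutomorphicLoop.{u, u} 3 F x y →
        (∀ w : F, ∃! a : IntOctuple, w = IsLoop.canonicalWord x y a) ∧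
        ∃ φ : F ≃* IntOctuple, ∀ a : IntOctuple, φ (IsLoop.canonicalWord x y a) = a := by
  refine ⟨⟨IntOctuple.isFreeCommAutomorphicLoop, IntOctuple.upperCentral_two_ne⟩,
    fun F _ _ x y hF => ?_⟩
  obtain ⟨φ, hφ⟩ := hF.exists_mulEquiv
  refine ⟨fun w => ⟨φ w, φ.injective (hφ (φ w)).symm, ?_⟩, φ, hφ⟩
  rintro a rfl
  exact (hφ a).symm
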